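/- Write $I_{\mathbb Q}=\mathbb Q\cap[0,1]$. An oracle $B\in 2^{\mathbb N}$ has PA degree (is PA-complete) if $B$ computes a member of every nonempty $\Pi^0_1$ class $P\subseteq 2^{\mathbb N}$. A function $f\colon[0,1]\to\mathbb R$ is computable if its values at the rationals of $[0,1]$ are uniformly computable reals and $f$ has a computable modulus of uniform continuity. Let $(p_n,q_n)_{n\in\mathbb N}$ be an effective listing of all pairs in $I_{\mathbb Q}\times\mathbb Q$; a function $g\colon I_{\mathbb Q}\to\mathbb R$ is encoded by the sequence $Z_g\in 2^{\mathbb N}$ with $Z_g(2n)=1\leftrightarrow g(p_n)<q_n$ and $Z_g(2n+1)=1\leftrightarrow g(p_n)>q_n$, and $B$ computes $g$ if $Z_g\le_{\mathrm T}B$. Write $f\le_{\mathtt{slope}}g$ if $f(y)-f(x)\le g(y)-g(x)$ for all $x<y$ in $I_{\mathbb Q}$. **Theorem.** Let $B$ be an oracle. Then $B$ has PA degree if and only if, for every computable function $f\colon[0,1]\to\mathbb R$ of bounded variation, $B$ computes a nondecreasing function $g\colon I_{\mathbb Q}\to\mathbb R$ with $f\le_{\mathtt{slope}}g$. Moreover,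 for every computable function $f\colon[0,1]\to\mathbb R$ of bounded variation, $B$ computes a nondecreasing $g\colon I_{\mathbb Q}\to\mathbb R$ with $f\le_{\mathtt{slope}}g$ if and only if $B$ computes a Jordan decomposition of $f$ on $I_{\mathbb Q}$, that is, $B$ computes nondecreasing functions $g,h\colon I_{\mathbb Q}\to\mathbb R$ with $f=g-h$ on $I_{\mathbb Q}$. -/

import Mathlib

namespace JordanPA

/-! ### Oracle computation and PA degree -/

/-- `B` computes `Z`: the sequence `Z` is Turing reducible to the oracle `B`
(an element of Cantor space, identified with a set of natural numbers). -/
def Computes (B Z : ℕ → Bool) : Prop :=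
  ComputableIn {fun n => Part.some (B n).toNat} Z

/-- `P` is an (effectively closed) `Π⁰₁` class in Cantor space: `P` consists of the sequences
all of whose finite initial segments satisfy some fixed computable predicate on strings. -/
def IsPi01Class (P : Set (ℕ → Bool)) : Prop :=
  ∃ R : List Bool → Bool, Computable R ∧
    P = {X | ∀ n : ℕ, R ((List.range n).map X) = true}

/-- `B` has PA degree (is PA-complete): `B` computes a member of every nonempty `Π⁰₁` class. -/
def HasPADegree (B : ℕ → Bool) : Prop :=
  ∀ P : Set (ℕ → Bool), IsPi01Class P → P.Nonempty → ∃ X ∈ P, Computes B X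

/-! ### Effective listings of the rationals -/

/-- An effective listing (with repetitions) of all rationals: the triple `(a, b, c)` codes
`(a - b) / (c + 1)`. -/
def rat (k : ℕ) : ℚ :=
  ((k.unpair.1 : ℚ) - k.unpair.2.unpair.1) / (k.unpair.2.unpair.2 + 1)

theorem rat_surjective : Function.Surjective rat := by
  intro q
  have hd : (0 : ℚ) < q.den := by exact_mod_cast q.den_pos
  refine ⟨Nat.pair q.num.toNat (Nat.pair (-q.num).toNat (q.den - 1)), ?_⟩
  have h1 : ((q.den - 1 : ℕ) : ℚ) + 1 = q.den := by
    have := q.den_pos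
    rw [Nat.cast_sub (by omega)]; simp
  have h2 : ((q.num.toNat : ℚ) - ((-q.num).toNat : ℚ)) = q.num := by
    have : ((q.num.toNat : ℤ) - ((-q.num).toNat : ℤ)) = q.num := by omega
    exact_mod_cast this
  simp only [rat, Nat.unpair_pair, h1, h2]
  exact q.num_div_den

/-- `I_ℚ`, the rationals in `[0,1]`. -/
abbrev IQ : Type := Set.Icc (0 : ℚ) 1

/-- An effective listing (with repetitions) of `I_ℚ`: the pair `(a, b)` codes
`min a (b + 1) / (b + 1)`. -/
def unitRat (k : ℕ) : IQ :=
  ⟨((min k.unpair.1 (k.unpair.2 + 1) : ℕ) : ℚ) / (k.unpair.2 + 1), by positivity, by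
    rw [div_le_one (by positivity)]
    exact_mod_cast min_le_right _ _⟩

theorem unitRat_surjective : Function.Surjective unitRat := by
  rintro ⟨q, h0, h1⟩
  have hn : 0 ≤ q.num := Rat.num_nonneg.2 h0
  have hd := q.den_pos
  have hle : q.num ≤ q.den := by
    rw [← Rat.num_div_den q, div_le_one (by exact_mod_cast hd)] at h1
    exact_mod_cast h1
  refine ⟨Nat.pair q.num.toNat (q.den - 1), Subtype.ext ?_⟩
  have e1 : ((q.den - 1 : ℕ) : ℚ) + 1 = q.den := by
    rw [Nat.cast_sub (by omega)]; simp
  have e2 : min q.num.toNat (q.den - 1 + 1) = q.num.toNat := by omega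
  have e3 : ((q.num.toNat : ℕ) : ℚ) = q.num := by
    exact_mod_cast Int.toNat_of_nonneg hn
  simp only [unitRat, Nat.unpair_pair, e1, e2, e3]
  exact q.num_div_den

/-- The inclusion of `I_ℚ` in the real unit interval. -/
def IQ.toReal (q : IQ) : Set.Icc (0 : ℝ) 1 :=
  ⟨((q : ℚ) : ℝ), by exact_mod_cast q.2.1, by exact_mod_cast q.2.2⟩

/-! ### Computability of real valued functions -/

/-- `f : [0,1] → ℝ` is computable: its values at rationals are uniformly computable reals
(the `n`-th term of the name is within `2⁻ⁿ` of the value), and it has a computable modulus of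
uniform continuity. -/
def IsComputableFunction (f : Set.Icc (0 : ℝ) 1 → ℝ) : Prop :=
  (∃ a : ℕ → ℕ → ℕ, Computable₂ a ∧
    ∀ i n : ℕ, |f (unitRat i).toReal - rat (a i n)| ≤ (1 / 2 : ℝ) ^ n) ∧
  (∃ m : ℕ → ℕ, Computable m ∧
    ∀ (n : ℕ) (x y : Set.Icc (0 : ℝ) 1),
      |(x : ℝ) - y| ≤ (1 / 2 : ℝ) ^ m n → |f x - f y| ≤ (1 / 2 : ℝ) ^ n)

/-- The element of Cantor space that encodes `g : I_ℚ → ℝ`. With `(pₙ, qₙ)` the effective listing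
of all pairs in `I_ℚ × ℚ`, bit `2n` says whether `g pₙ < qₙ`, and bit `2n + 1` whether
`g pₙ > qₙ`. -/
noncomputable def code (g : IQ → ℝ) (k : ℕ) : Bool :=
  let p : IQ := unitRat (k / 2).unpair.1
  let q : ℝ := rat (k / 2).unpair.2
  if k % 2 = 0 then decide (g p < q) else decide (g p > q)

/-- The oracle `B` computes `g : I_ℚ → ℝ`. -/
def ComputesFunction (B : ℕ → Bool) (g : IQ → ℝ) : Prop :=
  Computes B (code g)

/-! ### Slopes and Jordan decompositions -/

/-- `f ≤_slope g`, on `I_ℚ`: increments of `f` are bounded by those of `g`. -/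
def SlopeLE (f g : IQ → ℝ) : Prop :=
  ∀ x y : IQ, x < y → f y - f x ≤ g y - g x

/-- `B` computes a nondecreasing `g : I_ℚ → ℝ` with `f ≤_slope g` (on `I_ℚ`). -/
def ComputesSlopeBound (B : ℕ → Bool) (f : Set.Icc (0 : ℝ) 1 → ℝ) : Prop :=
  ∃ g : IQ → ℝ, Monotone g ∧ ComputesFunction B g ∧ SlopeLE (fun q => f q.toReal) g

/-- `B` computes a Jordan decomposition of `f` on `I_ℚ`. -/
def ComputesJordanDecomposition (B : ℕ → Bool) (f : Set.Icc (0 : ℝ) 1 → ℝ) : Prop :=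
  ∃ g h : IQ → ℝ, Monotone g ∧ Monotone h ∧ ComputesFunction B g ∧ ComputesFunction B h ∧
    ∀ q : IQ, f q.toReal = g q - h q

end JordanPA

-- A slope bound `g` of `f` and a Jordan decomposition `f = g - h` are the same thing up to
-- encoding: `h = g - f` is nondecreasing exactly because increments of `f` are bounded by those of
-- `g`. From `g` the oracle can approximate `g - f`, but not decide its comparisons with rationals.
-- `NatApprox.exists_shift` removes this obstacle: adding to both functions one real `d`, built
-- digit by digit, makes every value differ from every rational, so that all comparisons become
-- decidable.
--
-- From PA degree to slope bounds (`HasPADegree.computesSlopeBound`): the cuts of bounded slope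
-- bounds of `f` obey closed conditions, which define a `Π⁰₁` class. The variation function of `f`
-- shows that the class is nonempty. A member of the class yields approximations to a slope bound,
-- and a shift makes it computable in the sense of `code`.
--
-- From slope bounds to PA degree (`hasPADegree_of_computesSlopeBound`): let `T` be a computable
-- tree whose paths give members of the class. When the node with code `b` is first seen at stage
-- `s` to have no descendants, `f` receives in `[2^(-b-1), 2^(-b)]` a saw of tiny height but total
-- rise `2^(-b)`, on the part named by a node `c s` of `T` of level `s`. Small heights make `f`
-- computable; since each `b` dies at most once, the variation of `f` is at most `∑ 2^(1-b)`. A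
-- slope bound `g` must grow by `2^(-b)` over that part (`bumps_increment`).
--
-- Two cases then produce a path (`exists_path_of_dies_increment`). If for each `b` some level of
-- `T` has no node with an increment of `g` of about `2^(-b)`, such a level can be found and bounds
-- the stage at which `b` dies, because increments only grow towards the root; so extendibility is
-- decidable from `B`. Otherwise, for some `b`, nodes with large increments exist at all levels. By
-- König's lemma a path runs through them, and from some level on the path is computed by going to
-- the half with the larger increment.

attribute [fun_prop] ComputableIn

/-! ### Closure properties of computability relative to oracles -/

namespace ComputableIn

variable {α β γ σ : Type*} [Primcodable α] [Primcodable β] [Primcodable γ] [Primcodable σ]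
variable {O : Set (ℕ →. ℕ)}

open Encodable Part

theorem of_eq {f g : α → σ} (hf : ComputableIn O f) (H : ∀ n, f n = g n) :
    ComputableIn O g :=
  (funext H : f = g) ▸ hf

@[fun_prop]
theorem id' : ComputableIn O (fun a : α => a) := ComputableIn.id

@[fun_prop]
theorem const' (s : σ) : ComputableIn O (fun _ : α => s) := ComputableIn.const s

@[fun_prop]
theorem comp {f : β → σ} {g : α → β} (hf : ComputableIn O f)
    (hg : ComputableIn O g) : ComputableIn O fun a => f (g a) :=
  (Nat.RecursiveIn.comp hf hg).of_eq fun n => by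
    simp only [map_some, bind_eq_bind]
    rcases e : decode (α := α) n with - | a <;> simp [encodek]

@[fun_prop]
theorem pair {f : α → β} {g : α → γ} (hf : ComputableIn O f)
    (hg : ComputableIn O g) : ComputableIn O fun a => (f a, g a) :=
  (Nat.RecursiveIn.pair hf hg).of_eq fun n => by
    rcases e : decode (α := α) n with - | a <;> simp [Seq.seq]

@[fun_prop]
theorem fst' {f : α → β × γ} (hf : ComputableIn O f) :
    ComputableIn O fun a => (f a).1 := comp ComputableIn.fst hf

@[fun_prop]
theorem snd' {f : α → β × γ} (hf : ComputableIn O f) :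
    ComputableIn O fun a => (f a).2 := comp ComputableIn.snd hf

theorem of_primrec₂ {op : β → γ → σ} (h : Primrec₂ op) {f : α → β} {g : α → γ}
    (hf : ComputableIn O f) (hg : ComputableIn O g) : ComputableIn O fun a => op (f a) (g a) :=
  comp (f := fun p : β × γ => op p.1 p.2) h.computableIn₂ (pair hf hg)

theorem of_primrec {op : β → σ} (h : Primrec op) {f : α → β}
    (hf : ComputableIn O f) : ComputableIn O fun a => op (f a) :=
  comp h.computableIn hf

/-- Primitive recursion. -/
theorem nat_rec {f : α → ℕ} {g : α → σ} {h : α → ℕ × σ → σ} (hf : ComputableIn O f)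
    (hg : ComputableIn O g) (hh : ComputableIn O fun p : α × ℕ × σ => h p.1 p.2) :
    ComputableIn O fun a => Nat.rec (motive := fun _ => σ) (g a) (fun y IH => h a (y, IH)) (f a) := by
  have hr := Nat.RecursiveIn.comp (Nat.RecursiveIn.prec hg hh)
    (ComputableIn.pair ComputableIn.id hf)
  refine hr.of_eq fun n => ?_
  rcases e : decode (α := α) n with - | a
  · simp
  · simp only [coe_some, bind_some, map_some, bind_eq_bind, encode_prod_val,
      Nat.unpair_pair, _root_.id]
    induction f a with
    | zero => simp [encodek]
    | succ m ih =>
      simp only [encode_nat] at ih ⊢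
      change Part.bind (Nat.rec _ _ m) _ = _
      rw [ih]
      simp [encodek]

/-- A sequence that is defined by a computable recursion is computable. -/
theorem of_succ {F : ℕ → σ} {h : ℕ × σ → σ} (hh : ComputableIn O h)
    (hF : ∀ n, F (n + 1) = h (n, F n)) : ComputableIn O F := by
  have h' : ComputableIn O fun p : ℕ × ℕ × σ => h p.2 := by fun_prop
  refine (nat_rec (f := fun n : ℕ => n) (g := fun _ => F 0) (h := fun _ p => h p)
    (by fun_prop) (by fun_prop) h').of_eq fun n => ?_
  induction n with
  | zero => rfl
  | succ n ih => simp only [hF, ← ih]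

theorem cond' {c : α → Bool} {f g : α → σ} (hc : ComputableIn O c) (hf : ComputableIn O f)
    (hg : ComputableIn O g) : ComputableIn O fun a => bif c a then f a else g a := by
  have hc' : ComputableIn O fun a => (c a).toNat := of_primrec (Primrec.dom_bool _) hc
  have hf' : ComputableIn O fun p : α × ℕ × σ => f p.1 := by fun_prop
  refine (nat_rec (h := fun a _ => f a) hc' hg hf').of_eq fun a => ?_
  cases c a <;> rfl

@[fun_prop]
theorem ite {c : α → Prop} [DecidablePred c] {f g : α → σ}
    (hc : ComputableIn O fun a => decide (c a)) (hf : ComputableIn O f)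
    (hg : ComputableIn O g) : ComputableIn O fun a => if c a then f a else g a :=
  (cond' hc hf hg).of_eq fun a => by by_cases h : c a <;> simp [h]

/-- Unbounded search that always succeeds. -/
theorem find {p : α → ℕ → Prop} [∀ a n, Decidable (p a n)]
    (hp : ComputableIn O fun q : α × ℕ => decide (p q.1 q.2)) (h : ∀ a, ∃ n, p a n) :
    ComputableIn O fun a => Nat.find (h a) := by
  -- The search operator looks for a zero, hence the negation.
  have hp' : ComputableIn O fun q : α × ℕ => (!decide (p q.1 q.2)).toNat :=
    of_primrec (Primrec.dom_bool fun b => (!b).toNat) hp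
  refine (Nat.RecursiveIn.rfind hp').of_eq fun n => ?_
  rcases e : decode (α := α) n with - | a
  · simp only [coe_none, bind_none]
    apply Nat.rfind_zero_none
    simp [e]
  · simp only [coe_some, bind_some, map_some]
    refine Part.eq_some_iff.2 ?_
    have hs := Nat.find_spec (h a)
    refine Nat.mem_rfind.2 ⟨?_, fun {m} hm => ?_⟩
    · simp [e, hs]
    · have := Nat.find_min (h a) hm
      simp [e, this]

@[fun_prop]
theorem decide_and {p q : α → Prop} [DecidablePred p] [DecidablePred q]
    (hp : ComputableIn O fun a => decide (p a)) (hq : ComputableIn O fun a => decide (q a)) :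
    ComputableIn O fun a => decide (p a ∧ q a) :=
  (of_primrec₂ Primrec.and hp hq).of_eq fun a => by simp

@[fun_prop]
theorem decide_not {p : α → Prop} [DecidablePred p]
    (hp : ComputableIn O fun a => decide (p a)) : ComputableIn O fun a => decide (¬ p a) :=
  (of_primrec Primrec.not hp).of_eq fun a => by simp

@[fun_prop]
theorem decide_imp {p q : α → Prop} [DecidablePred p] [DecidablePred q]
    (hp : ComputableIn O fun a => decide (p a)) (hq : ComputableIn O fun a => decide (q a)) :
    ComputableIn O fun a => decide (p a → q a) :=
  (of_primrec₂ Primrec.or (of_primrec Primrec.not hp) hq).of_eq fun a => by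
    by_cases p a <;> by_cases q a <;> simp_all

@[fun_prop]
theorem decide_le {f g : α → ℕ} (hf : ComputableIn O f) (hg : ComputableIn O g) :
    ComputableIn O fun a => decide (f a ≤ g a) :=
  of_primrec₂ Primrec.nat_le.decide hf hg

@[fun_prop]
theorem decide_lt {f g : α → ℕ} (hf : ComputableIn O f) (hg : ComputableIn O g) :
    ComputableIn O fun a => decide (f a < g a) :=
  of_primrec₂ Primrec.nat_lt.decide hf hg

@[fun_prop]
theorem decide_eq {f g : α → ℕ} (hf : ComputableIn O f) (hg : ComputableIn O g) :
    ComputableIn O fun a => decide (f a = g a) :=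
  of_primrec₂ (Primrec.eq (α := ℕ)).decide hf hg

@[fun_prop]
theorem decide_eq_true' {f : α → Bool} (hf : ComputableIn O f) :
    ComputableIn O fun a => decide (f a = true) :=
  hf.of_eq fun a => by simp

@[fun_prop]
theorem decide_eq_false' {f : α → Bool} (hf : ComputableIn O f) :
    ComputableIn O fun a => decide (f a = false) :=
  (of_primrec Primrec.not hf).of_eq fun a => by cases f a <;> simp

@[fun_prop]
theorem nat_add {f g : α → ℕ} (hf : ComputableIn O f) (hg : ComputableIn O g) :
    ComputableIn O fun a => f a + g a := of_primrec₂ Primrec.nat_add hf hg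

@[fun_prop]
theorem nat_sub {f g : α → ℕ} (hf : ComputableIn O f) (hg : ComputableIn O g) :
    ComputableIn O fun a => f a - g a := of_primrec₂ Primrec.nat_sub hf hg

@[fun_prop]
theorem nat_mul {f g : α → ℕ} (hf : ComputableIn O f) (hg : ComputableIn O g) :
    ComputableIn O fun a => f a * g a := of_primrec₂ Primrec.nat_mul hf hg

@[fun_prop]
theorem nat_div {f g : α → ℕ} (hf : ComputableIn O f) (hg : ComputableIn O g) :
    ComputableIn O fun a => f a / g a := of_primrec₂ Primrec.nat_div hf hg

@[fun_prop]
theorem nat_mod {f g : α → ℕ} (hf : ComputableIn O f) (hg : ComputableIn O g) :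
    ComputableIn O fun a => f a % g a := of_primrec₂ Primrec.nat_mod hf hg

@[fun_prop]
theorem nat_min {f g : α → ℕ} (hf : ComputableIn O f) (hg : ComputableIn O g) :
    ComputableIn O fun a => min (f a) (g a) := of_primrec₂ Primrec.nat_min hf hg

@[fun_prop]
theorem nat_pow {f g : α → ℕ} (hf : ComputableIn O f) (hg : ComputableIn O g) :
    ComputableIn O fun a => f a ^ g a := by
  have h : ComputableIn O fun p : α × ℕ × ℕ => p.2.2 * f p.1 := by fun_prop
  refine (nat_rec (h := fun a p => p.2 * f a) hg (const' 1) h).of_eq fun a => ?_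
  induction g a with
  | zero => rfl
  | succ n ih => simp only [pow_succ, ← ih]

@[fun_prop]
theorem nat_pair {f g : α → ℕ} (hf : ComputableIn O f) (hg : ComputableIn O g) :
    ComputableIn O fun a => Nat.pair (f a) (g a) := of_primrec₂ Primrec₂.natPair hf hg

@[fun_prop]
theorem nat_unpair {f : α → ℕ} (hf : ComputableIn O f) :
    ComputableIn O fun a => Nat.unpair (f a) := of_primrec Primrec.unpair hf

@[fun_prop]
theorem sum_range {n : α → ℕ} {f : α → ℕ → ℕ} (hn : ComputableIn O n)
    (hf : ComputableIn O fun p : α × ℕ => f p.1 p.2) :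
    ComputableIn O fun a => ∑ k ∈ Finset.range (n a), f a k := by
  have h : ComputableIn O fun p : α × ℕ × ℕ => p.2.2 + f p.1 p.2.1 := by
    have : ComputableIn O fun p : α × ℕ × ℕ => f p.1 p.2.1 :=
      comp hf (g := fun p : α × ℕ × ℕ => (p.1, p.2.1)) (by fun_prop)
    fun_prop
  refine (nat_rec (h := fun a p => p.2 + f a p.1) hn (const' 0) h).of_eq fun a => ?_
  induction n a with
  | zero => rfl
  | succ n ih => simp only [Finset.sum_range_succ, ← ih]

@[fun_prop]
theorem decide_ball {n : α → ℕ} {p : α → ℕ → Prop} [∀ a k, Decidable (p a k)]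
    (hn : ComputableIn O n) (hp : ComputableIn O fun q : α × ℕ => decide (p q.1 q.2)) :
    ComputableIn O fun a => decide (∀ k < n a, p a k) := by
  -- A bounded universal statement holds when the number of its failures is zero.
  have h := sum_range hn (f := fun a k => if p a k then 0 else 1) (by fun_prop)
  refine (decide_eq h (const' 0)).of_eq fun a => ?_
  simp [Finset.sum_eq_zero_iff]

theorem list_map_range {n : α → ℕ} {f : α → ℕ → σ} (hn : ComputableIn O n)
    (hf : ComputableIn O fun p : α × ℕ => f p.1 p.2) :
    ComputableIn O fun a => (List.range (n a)).map (f a) := by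
  have h : ComputableIn O fun p : α × ℕ × List σ => p.2.2 ++ [f p.1 p.2.1] := by
    have h1 : ComputableIn O fun p : α × ℕ × List σ => f p.1 p.2.1 :=
      comp hf (g := fun p : α × ℕ × List σ => (p.1, p.2.1)) (by fun_prop)
    have h2 : ComputableIn O fun p : α × ℕ × List σ => p.2.2 := by fun_prop
    exact of_primrec₂ Primrec.list_concat h2 h1
  refine (nat_rec (h := fun a p => p.2 ++ [f a p.1]) hn (const' []) h).of_eq fun a => ?_
  induction n a with
  | zero => rfl
  | succ n ih => simp only [List.range_succ, List.map_append, List.map_cons, List.map_nil, ← ih]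

theorem of_computable {f : α → σ} (hf : Computable f) : ComputableIn O f := hf.computableIn

theorem computable {f : α → σ} (hf : ComputableIn {} f) : Computable f :=
  recursiveIn_empty_iff.1 hf

end ComputableIn

namespace JordanPA

attribute [local irreducible] ComputableIn

open ComputableIn

/-! ### Approximable reals, and shifts that make comparison with rationals decidable -/

/-- The set of partial functions available to a computation with oracle `B`. -/
abbrev oracle (B : ℕ → Bool) : Set (ℕ →. ℕ) := {fun n => Part.some (B n).toNat}

/-- The nonnegative reals `r i` are approximated, uniformly and with the oracles `O`, by dyadic
rationals with natural numerators. -/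
def NatApprox (O : Set (ℕ →. ℕ)) (r : ℕ → ℝ) : Prop :=
  ∃ A : ℕ → ℕ → ℕ, ComputableIn O (fun p : ℕ × ℕ => A p.1 p.2) ∧
    ∀ i n, |2 ^ n * r i - A i n| ≤ 2

theorem NatApprox.of_empty {O : Set (ℕ →. ℕ)} {r : ℕ → ℝ} (h : NatApprox {} r) :
    NatApprox O r := by
  obtain ⟨A, hA, h⟩ := h
  exact ⟨A, .of_computable hA.computable, h⟩

theorem rat_cast (j : ℕ) : ((rat j : ℚ) : ℝ) =
    ((j.unpair.1 : ℝ) - j.unpair.2.unpair.1) / (j.unpair.2.unpair.2 + 1) := by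
  simp [rat]

/-- The integer part of `N * (u - v) / (w + 1)`, or `0` if this is negative. -/
theorem truncated_floor (N u v w : ℕ) :
    ((N * (u - v) / (w + 1) : ℕ) : ℝ) ≤ N * max (((u : ℝ) - v) / (w + 1)) 0 ∧
    (N : ℝ) * max (((u : ℝ) - v) / (w + 1)) 0 ≤ (N * (u - v) / (w + 1) : ℕ) + 1 := by
  have hw : (0 : ℝ) < (w : ℝ) + 1 := by positivity
  have key : (N : ℝ) * max (((u : ℝ) - v) / (w + 1)) 0 = (N * (u - v) : ℕ) / ((w + 1 : ℕ) : ℝ) := by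
    rcases le_total v u with h | h
    · have h' : (v : ℝ) ≤ u := by exact_mod_cast h
      rw [max_eq_left (div_nonneg (by linarith) hw.le)]
      push_cast [h]
      ring
    · have h' : (u : ℝ) ≤ v := by exact_mod_cast h
      rw [max_eq_right (div_nonpos_of_nonpos_of_nonneg (by linarith) hw.le),
        Nat.sub_eq_zero_of_le h]
      simp
  rw [key]
  refine ⟨Nat.cast_div_le, ?_⟩
  rw [div_le_iff₀ (by positivity)]
  exact_mod_cast (Nat.lt_div_mul_add (a := N * (u - v)) (Nat.succ_pos w)).le.trans
    (by simp [Nat.add_mul])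

/-- The integer part of `2 ^ n * max (rat j) 0`. -/
def ratFloor (j n : ℕ) : ℕ :=
  2 ^ n * (j.unpair.1 - j.unpair.2.unpair.1) / (j.unpair.2.unpair.2 + 1)

@[fun_prop]
theorem computableIn_ratFloor {O : Set (ℕ →. ℕ)} {α : Type*} [Primcodable α] {f g : α → ℕ}
    (hf : ComputableIn O f) (hg : ComputableIn O g) :
    ComputableIn O fun a => ratFloor (f a) (g a) := by
  unfold ratFloor
  fun_prop

theorem ratFloor_spec (j n : ℕ) : (ratFloor j n : ℝ) ≤ 2 ^ n * max (rat j : ℝ) 0 ∧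
    (2 : ℝ) ^ n * max (rat j : ℝ) 0 ≤ ratFloor j n + 1 := by
  have := truncated_floor (2 ^ n) j.unpair.1 j.unpair.2.unpair.1 j.unpair.2.unpair.2
  rw [rat_cast]
  push_cast at this
  exact this

theorem exists_floor_of_computesFunction {B : ℕ → Bool} {g : IQ → ℝ} (hg : ComputesFunction B g)
    (c : ℕ) (hc : ∀ q, 0 ≤ g q + c) :
    ∃ A : ℕ → ℕ → ℕ, ComputableIn (oracle B) (fun p : ℕ × ℕ => A p.1 p.2) ∧
      ∀ i n, (A i n : ℝ) ≤ 2 ^ n * (g (unitRat i) + c) ∧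
        2 ^ n * (g (unitRat i) + c) < A i n + 1 := by
  have hg' : ComputableIn (oracle B) (code g) := hg
  -- The bit at `φ (i, n) m` asks whether the value at `i` is below `(m + 1) / 2 ^ n - c`. The least
  -- `m` with a positive answer is the integer part of `2 ^ n * (g + c)`.
  set φ : ℕ × ℕ → ℕ → ℕ := fun p m =>
    2 * Nat.pair p.1 (Nat.pair (m + 1) (Nat.pair (c * 2 ^ p.2) (2 ^ p.2 - 1))) with hφ
  have hcode : ∀ p m, code g (φ p m) = true ↔ 2 ^ p.2 * (g (unitRat p.1) + c) < m + 1 := by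
    intro p m
    have h2 : ((2 ^ p.2 - 1 : ℕ) : ℝ) + 1 = 2 ^ p.2 := by
      rw [Nat.cast_sub Nat.one_le_two_pow]; simp
    have hp : (0 : ℝ) < 2 ^ p.2 := by positivity
    simp only [code, hφ, Nat.mul_mod_right, if_true, decide_eq_true_eq, rat_cast,
      Nat.mul_div_cancel_left _ (Nat.two_pos), Nat.unpair_pair, h2]
    rw [lt_div_iff₀ hp]
    push_cast
    constructor <;> intro h <;> linarith
  have hex : ∀ p : ℕ × ℕ, ∃ m, code g (φ p m) = true := by
    intro p
    obtain ⟨m, hm⟩ := exists_nat_gt (2 ^ p.2 * (g (unitRat p.1) + c))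
    exact ⟨m, (hcode p m).2 (by linarith)⟩
  refine ⟨fun i n => Nat.find (hex (i, n)), ?_, fun i n => ?_⟩
  · have hφc : ComputableIn (oracle B) fun q : (ℕ × ℕ) × ℕ => φ q.1 q.2 := by
      simp only [hφ]
      fun_prop
    exact find (p := fun p m => code g (φ p m) = true) (.decide_eq_true' (hg'.comp hφc)) hex
  · have h1 := (hcode _ _).1 (Nat.find_spec (hex (i, n)))
    refine ⟨?_, h1⟩
    rcases h : Nat.find (hex (i, n)) with - | m
    · beta_reduce
      rw [h, Nat.cast_zero]
      exact mul_nonneg (pow_nonneg zero_le_two n) (hc (unitRat i))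
    · have h2 := Nat.find_min (hex (i, n)) (m := m) (by omega)
      rw [hcode] at h2
      beta_reduce
      rw [h]
      push_cast
      exact not_lt.1 h2

theorem NatApprox.of_computesFunction {B : ℕ → Bool} {g : IQ → ℝ} (hg : ComputesFunction B g)
    (c : ℕ) (hc : ∀ q, 0 ≤ g q + c) : NatApprox (oracle B) fun i => g (unitRat i) + c := by
  obtain ⟨A, hA, h⟩ := exists_floor_of_computesFunction hg c hc
  refine ⟨A, hA, fun i n => abs_le.2 ?_⟩
  obtain ⟨h1, h2⟩ := h i n
  constructor <;> linarith

theorem NatApprox.of_isComputableFunction {f : Set.Icc (0 : ℝ) 1 → ℝ}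
    (hf : IsComputableFunction f) (c : ℕ) (hc : ∀ x, 0 ≤ f x + c) :
    NatApprox {} fun i => f (unitRat i).toReal + c := by
  obtain ⟨⟨a, ha, hfa⟩, -⟩ := hf
  have ha' : ComputableIn {} fun p : ℕ × ℕ => a p.1 p.2 := .of_computable ha
  refine ⟨fun i n => 2 ^ n * ((a i n).unpair.1 + c * ((a i n).unpair.2.unpair.2 + 1)
    - (a i n).unpair.2.unpair.1) / ((a i n).unpair.2.unpair.2 + 1), by fun_prop, fun i n => ?_⟩
  obtain ⟨h1, h2⟩ := truncated_floor (2 ^ n) ((a i n).unpair.1 + c * ((a i n).unpair.2.unpair.2 + 1))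
    (a i n).unpair.2.unpair.1 (a i n).unpair.2.unpair.2
  have h0 := hfa i n
  rw [rat_cast] at h0
  have hpos : (0 : ℝ) < (a i n).unpair.2.unpair.2 + 1 := by positivity
  have e : ((((a i n).unpair.1 + c * ((a i n).unpair.2.unpair.2 + 1) : ℕ) : ℝ)
      - (a i n).unpair.2.unpair.1) / ((a i n).unpair.2.unpair.2 + 1) =
      ((a i n).unpair.1 - (a i n).unpair.2.unpair.1) / ((a i n).unpair.2.unpair.2 + 1) + c := by
    push_cast
    field_simp
    ring
  rw [e] at h1 h2
  generalize ((a i n).unpair.1 - (a i n).unpair.2.unpair.1) / ((a i n).unpair.2.unpair.2 + 1 : ℝ)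
    = x at *
  -- Truncating a negative approximation to `0` does no harm, since the approximated value is
  -- nonnegative and `max · 0` is 1-Lipschitz.
  have h3 : |f (unitRat i).toReal + c - max (x + c) 0| ≤ (1 / 2) ^ n := by
    have := hc (unitRat i).toReal
    calc _ = |max (f (unitRat i).toReal + c) 0 - max (x + c) 0| := by rw [max_eq_left this]
      _ ≤ |f (unitRat i).toReal + c - (x + c)| := abs_max_sub_max_le_abs _ _ _
      _ ≤ _ := by rwa [add_sub_add_right_eq_sub]
  have h4 : |2 ^ n * (f (unitRat i).toReal + c) - 2 ^ n * max (x + c) 0| ≤ 1 := by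
    rw [← mul_sub, abs_mul, abs_of_pos (by positivity)]
    calc _ ≤ (2 : ℝ) ^ n * (1 / 2) ^ n := by gcongr
      _ = 1 := by rw [← mul_pow]; norm_num
  push_cast at h1 h2
  rw [abs_le] at h4 ⊢
  push_cast
  constructor <;> linarith [h4.1, h4.2]

/-- A difference of approximable reals, shifted to be nonnegative. -/
theorem NatApprox.sub_add {O : Set (ℕ →. ℕ)} {r s : ℕ → ℝ} (hr : NatApprox O r)
    (hs : NatApprox O s) (c : ℕ) (h0 : ∀ i, 0 ≤ r i - s i + c) :
    NatApprox O fun i => r i - s i + c := by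
  obtain ⟨A, hA, hrA⟩ := hr
  obtain ⟨A', hA', hsA⟩ := hs
  -- With two extra bits the errors `2 + 2` shrink to `1` after division by `4`; rounding down adds
  -- at most `1` more.
  refine ⟨fun i n => (A i (n + 2) + c * 2 ^ (n + 2) - A' i (n + 2)) / (3 + 1), ?_, fun i n => ?_⟩
  · have h1 := ComputableIn.comp hA (g := fun p : ℕ × ℕ => (p.1, p.2 + 2)) (by fun_prop)
    have h2 := ComputableIn.comp hA' (g := fun p : ℕ × ℕ => (p.1, p.2 + 2)) (by fun_prop)
    simp only at h1 h2
    fun_prop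
  · have h1 := abs_le.1 (hrA i (n + 2))
    have h2 := abs_le.1 (hsA i (n + 2))
    obtain ⟨h3, h4⟩ := truncated_floor 1 (A i (n + 2) + c * 2 ^ (n + 2)) (A' i (n + 2)) 3
    have h5 : (0 : ℝ) ≤ 2 ^ n * (r i - s i + c) := mul_nonneg (by positivity) (h0 i)
    have e : (2 : ℝ) ^ (n + 2) = 4 * 2 ^ n := by ring
    rw [e] at h1 h2
    rw [abs_le]
    beta_reduce
    simp only [Nat.cast_one, one_mul] at h3 h4
    generalize (A i (n + 2) + c * 2 ^ (n + 2) - A' i (n + 2)) / (3 + 1) = m at *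
    push_cast at h3 h4
    rw [e] at h3 h4
    rcases max_cases (((A i (n + 2) : ℝ) + c * (4 * 2 ^ n) - A' i (n + 2)) / (3 + 1)) 0 with
      ⟨h, h'⟩ | ⟨h, h'⟩ <;>
    · rw [h] at h3 h4
      constructor <;> linarith [h1.1, h1.2, h2.1, h2.2]

/-- Alternation of two sequences. -/
theorem NatApprox.interleave {O : Set (ℕ →. ℕ)} {r s : ℕ → ℝ} (hr : NatApprox O r)
    (hs : NatApprox O s) : NatApprox O fun i => if i % 2 = 0 then r (i / 2) else s (i / 2) := by
  obtain ⟨A, hA, hrA⟩ := hr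
  obtain ⟨A', hA', hsA⟩ := hs
  refine ⟨fun i n => if i % 2 = 0 then A (i / 2) n else A' (i / 2) n, ?_, fun i n => ?_⟩
  · have h1 := ComputableIn.comp hA (g := fun p : ℕ × ℕ => (p.1 / 2, p.2)) (by fun_prop)
    have h2 := ComputableIn.comp hA' (g := fun p : ℕ × ℕ => (p.1 / 2, p.2)) (by fun_prop)
    simp only at h1 h2
    fun_prop
  · beta_reduce
    split_ifs
    · exact hrA _ _
    · exact hsA _ _

/-- Numerators, with denominators `16 ^ k`, of approximations from below to a real number whose
sum with the `i`-th approximated real avoids the `j`-th rational, for all `i` and `j`. -/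
def avoidDigits (A : ℕ → ℕ → ℕ) (k : ℕ) : ℕ :=
  Nat.rec 0 (fun k d => 16 * d +
    if ratFloor k.unpair.2 (4 * (k + 1)) ≤ A k.unpair.1 (4 * (k + 1)) + 16 * d + 7 ∧
      A k.unpair.1 (4 * (k + 1)) + 16 * d + 3 ≤ ratFloor k.unpair.2 (4 * (k + 1)) + 4
    then 12 else 3) k

/-- Stage `k` treats the pair `(i, j)` that `k` codes. The test asks whether the digit `3` would
leave the approximate sum within `4` of the approximate rational. If so, the digit `12` moves it `9`
further up; in either case the distance becomes at least `5`. -/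
theorem avoidDigits_succ (A : ℕ → ℕ → ℕ) (k : ℕ) :
    avoidDigits A (k + 1) = 16 * avoidDigits A k +
    if ratFloor k.unpair.2 (4 * (k + 1)) ≤ A k.unpair.1 (4 * (k + 1)) + 16 * avoidDigits A k + 7 ∧
      A k.unpair.1 (4 * (k + 1)) + 16 * avoidDigits A k + 3 ≤ ratFloor k.unpair.2 (4 * (k + 1)) + 4
    then 12 else 3 := rfl

theorem computableIn_avoidDigits {O : Set (ℕ →. ℕ)} {A : ℕ → ℕ → ℕ}
    (hA : ComputableIn O fun p : ℕ × ℕ => A p.1 p.2) : ComputableIn O (avoidDigits A) := by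
  refine of_succ (h := fun p => 16 * p.2 +
    if ratFloor p.1.unpair.2 (4 * (p.1 + 1)) ≤ A p.1.unpair.1 (4 * (p.1 + 1)) + 16 * p.2 + 7 ∧
      A p.1.unpair.1 (4 * (p.1 + 1)) + 16 * p.2 + 3 ≤ ratFloor p.1.unpair.2 (4 * (p.1 + 1)) + 4
    then 12 else 3) ?_ (avoidDigits_succ A)
  have h := ComputableIn.comp hA
    (g := fun p : ℕ × ℕ => (p.1.unpair.1, 4 * (p.1 + 1))) (by fun_prop)
  simp only at h
  fun_prop

/-- The intervals of length `16 ^ (-k)` are nested because every digit is at most `15`; `d` is a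
common point. -/
theorem exists_avoiding_real (A : ℕ → ℕ → ℕ) : ∃ d : ℝ, ∀ k,
    (avoidDigits A k : ℝ) ≤ 16 ^ k * d ∧ 16 ^ k * d ≤ avoidDigits A k + 1 := by
  set l : ℕ → ℝ := fun k => avoidDigits A k / 16 ^ k with hl
  set u : ℕ → ℝ := fun k => (avoidDigits A k + 1) / 16 ^ k with hu
  have hl' : Monotone l := by
    refine monotone_nat_of_le_succ fun k => ?_
    have : 16 * avoidDigits A k ≤ avoidDigits A (k + 1) := by
      rw [avoidDigits_succ]; omega
    have : (16 : ℝ) * avoidDigits A k ≤ avoidDigits A (k + 1) := by exact_mod_cast this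
    simp only [hl, pow_succ]
    rw [div_le_div_iff₀ (by positivity) (by positivity)]
    nlinarith [pow_pos (show (0 : ℝ) < 16 by norm_num) k]
  have hu' : Antitone u := by
    refine antitone_nat_of_succ_le fun k => ?_
    have : avoidDigits A (k + 1) + 1 ≤ 16 * (avoidDigits A k + 1) := by
      rw [avoidDigits_succ]; split_ifs <;> omega
    have : (avoidDigits A (k + 1) : ℝ) + 1 ≤ 16 * (avoidDigits A k + 1) := by exact_mod_cast this
    simp only [hu, pow_succ]
    rw [div_le_div_iff₀ (by positivity) (by positivity)]
    nlinarith [pow_pos (show (0 : ℝ) < 16 by norm_num) k]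
  have hlu : l ≤ u := fun k => by
    simp only [hl, hu]
    gcongr
    linarith
  have h := Monotone.ciSup_mem_iInter_Icc_of_antitone hl' hu' hlu
  refine ⟨⨆ n, l n, fun k => ?_⟩
  obtain ⟨h1, h2⟩ := Set.mem_iInter.1 h k
  simp only [hl, hu] at h1 h2 ⊢
  have hp : (0 : ℝ) < 16 ^ k := by positivity
  rw [div_le_iff₀ hp] at h1
  rw [le_div_iff₀ hp] at h2
  constructor <;> linarith

/-- A sequence of approximable reals can be shifted so that it avoids the rationals, and
comparison with rationals becomes decidable. -/
theorem NatApprox.exists_shift {O : Set (ℕ →. ℕ)} {r : ℕ → ℝ} (hr : NatApprox O r)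
    (h0 : ∀ i, 0 ≤ r i) : ∃ d : ℝ,
      ComputableIn O (fun p : ℕ × ℕ => decide (r p.1 + d < rat p.2)) ∧
      ∀ i j, r i + d ≠ rat j := by
  obtain ⟨A, hA, h⟩ := hr
  obtain ⟨d, hd⟩ := exists_avoiding_real A
  have hd0 : 0 ≤ d := by simpa using (Nat.cast_nonneg _).trans (hd 0).1
  have key : ∀ i j, (r i + d < rat j ↔ A i (4 * (Nat.pair i j + 1)) +
      avoidDigits A (Nat.pair i j + 1) < ratFloor j (4 * (Nat.pair i j + 1))) ∧
      r i + d ≠ rat j := by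
    intro i j
    set k := Nat.pair i j with hk
    have h1 := abs_le.1 (h i (4 * (k + 1)))
    obtain ⟨h2, h3⟩ := hd (k + 1)
    obtain ⟨h4, h5⟩ := ratFloor_spec j (4 * (k + 1))
    have hs := avoidDigits_succ A k
    have e : (16 : ℝ) ^ (k + 1) = 2 ^ (4 * (k + 1)) := by rw [pow_mul]; norm_num
    simp only [hk, Nat.unpair_pair] at hs
    rw [← hk] at hs
    rw [e] at h2 h3
    set N : ℝ := 2 ^ (4 * (k + 1)) with hN
    have hNpos : 0 < N := by positivity
    set a := A i (4 * (k + 1))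
    set q := ratFloor j (4 * (k + 1))
    -- The distance `5` exceeds the total error: `2` from the approximated real, `1` from the later
    -- digits of `d`, `1` from the rounding of the rational.
    have hlt : a + avoidDigits A (k + 1) + 5 ≤ q ∨ q + 5 ≤ a + avoidDigits A (k + 1) := by
      split_ifs at hs <;> omega
    have hmax : r i + d < max (rat j : ℝ) 0 ↔ a + avoidDigits A (k + 1) < q := by
      rw [← mul_lt_mul_iff_right₀ hNpos]
      rcases hlt with hlt | hlt
      · have : (a : ℝ) + avoidDigits A (k + 1) + 5 ≤ q := by exact_mod_cast hlt
        exact iff_of_true (by rw [mul_add]; linarith [h1.2]) (by omega)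
      · have : (q : ℝ) + 5 ≤ a + avoidDigits A (k + 1) := by exact_mod_cast hlt
        exact iff_of_false (by rw [mul_add, not_lt]; linarith [h1.1]) (by omega)
    have hne : r i + d ≠ max (rat j : ℝ) 0 := by
      intro hh
      have hh' : N * r i + N * d = N * max (rat j : ℝ) 0 := by rw [← hh]; ring
      rcases hlt with hlt | hlt
      · have : (a : ℝ) + avoidDigits A (k + 1) + 5 ≤ q := by exact_mod_cast hlt
        linarith [h1.2]
      · have : (q : ℝ) + 5 ≤ a + avoidDigits A (k + 1) := by exact_mod_cast hlt
        linarith [h1.1]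
    have hnn : 0 ≤ r i + d := add_nonneg (h0 i) hd0
    rw [← hmax]
    -- `ratFloor` sees only `max (rat j) 0`. For a negative rational it suffices that `r i + d` is
    -- nonnegative.
    rcases le_total 0 (rat j : ℝ) with hj | hj
    · rw [max_eq_left hj] at hne ⊢
      exact ⟨Iff.rfl, hne⟩
    · rw [max_eq_right hj] at hne ⊢
      have : 0 < r i + d := lt_of_le_of_ne hnn hne.symm
      exact ⟨iff_of_false (by linarith) (by linarith), by linarith⟩
  refine ⟨d, ?_, fun i j => (key i j).2⟩
  have hc : ComputableIn O fun p : ℕ × ℕ => decide (A p.1 (4 * (Nat.pair p.1 p.2 + 1)) +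
      avoidDigits A (Nat.pair p.1 p.2 + 1) < ratFloor p.2 (4 * (Nat.pair p.1 p.2 + 1))) := by
    have h1 := ComputableIn.comp hA
      (g := fun p : ℕ × ℕ => (p.1, 4 * (Nat.pair p.1 p.2 + 1))) (by fun_prop)
    have h2 := ComputableIn.comp (computableIn_avoidDigits hA)
      (g := fun p : ℕ × ℕ => Nat.pair p.1 p.2 + 1) (by fun_prop)
    simp only at h1 h2
    fun_prop
  exact hc.of_eq fun p => by simp only [(key p.1 p.2).1]

theorem computesFunction_of_irrational {B : ℕ → Bool} {g : IQ → ℝ}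
    (hc : ComputableIn (oracle B) fun p : ℕ × ℕ => decide (g (unitRat p.1) < rat p.2))
    (hne : ∀ i j, g (unitRat i) ≠ rat j) : ComputesFunction B g := by
  have h := ComputableIn.comp hc (g := fun k : ℕ => ((k / 2).unpair.1, (k / 2).unpair.2))
    (by fun_prop)
  have h' : ComputableIn (oracle B) fun k : ℕ =>
      if k % 2 = 0 then decide (g (unitRat (k / 2).unpair.1) < rat (k / 2).unpair.2)
      else decide (¬ g (unitRat (k / 2).unpair.1) < rat (k / 2).unpair.2) := by
    simp only at h
    exact .ite (by fun_prop) h (.decide_not h)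
  refine h'.of_eq fun k => ?_
  simp only [code]
  refine ite_congr rfl (fun _ => rfl) fun _ => ?_
  have := hne (k / 2).unpair.1 (k / 2).unpair.2
  simp only [decide_eq_decide, not_lt, gt_iff_lt]
  exact ⟨fun h => lt_of_le_of_ne h this.symm, le_of_lt⟩

/-- Both functions need the same `d`, so that their difference is preserved; hence the shift is
applied to the interleaved sequence. -/
theorem exists_common_shift {B : ℕ → Bool} {g h : IQ → ℝ}
    (hg : NatApprox (oracle B) fun i => g (unitRat i))
    (hh : NatApprox (oracle B) fun i => h (unitRat i)) (hg0 : ∀ q, 0 ≤ g q) (hh0 : ∀ q, 0 ≤ h q) :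
    ∃ d : ℝ, ComputesFunction B (fun q => g q + d) ∧ ComputesFunction B (fun q => h q + d) := by
  obtain ⟨d, hd, hne⟩ := (hg.interleave hh).exists_shift
    (fun i => by split_ifs; exacts [hg0 _, hh0 _])
  refine ⟨d, computesFunction_of_irrational ?_ fun i j => ?_,
    computesFunction_of_irrational ?_ fun i j => ?_⟩
  · refine (ComputableIn.comp hd (g := fun p : ℕ × ℕ => (2 * p.1, p.2)) (by fun_prop)).of_eq
      fun p => ?_
    simp
  · simpa using hne (2 * i) j
  · refine (ComputableIn.comp hd (g := fun p : ℕ × ℕ => (2 * p.1 + 1, p.2)) (by fun_prop)).of_eq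
      fun p => ?_
    simp [Nat.add_mod, Nat.add_div]
  · simpa [Nat.add_mod, Nat.add_div] using hne (2 * i + 1) j

/-! ### Slope bounds and Jordan decompositions -/

theorem exists_nat_bound {f : Set.Icc (0 : ℝ) 1 → ℝ} (hf : BoundedVariationOn f Set.univ) :
    ∃ c : ℕ, ∀ x, |f x| ≤ c := by
  obtain ⟨c, hc⟩ := exists_nat_ge (|f 0| + (eVariationOn f Set.univ).toReal)
  refine ⟨c, fun x => ?_⟩
  have := hf.dist_le (Set.mem_univ x) (Set.mem_univ 0)
  rw [Real.dist_eq] at this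
  have := abs_sub_abs_le_abs_sub (f x) (f 0)
  linarith

theorem IQ.toReal_mono {x y : IQ} (h : x ≤ y) : x.toReal ≤ y.toReal := by
  have : ((x : ℚ) : ℝ) ≤ ((y : ℚ) : ℝ) := by exact_mod_cast h
  exact this

theorem SlopeLE.monotone_sub {f g : IQ → ℝ} (h : SlopeLE f g) : Monotone fun q => g q - f q := by
  intro x y hxy
  rcases hxy.eq_or_lt with rfl | hlt
  · exact le_rfl
  · have := h x y hlt
    linarith

theorem exists_nat_add_nonneg {g : IQ → ℝ} (hg : Monotone g) : ∃ c : ℕ, ∀ q, 0 ≤ g q + c := by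
  obtain ⟨c, hc⟩ := exists_nat_ge (-g ⟨0, by norm_num⟩)
  refine ⟨c, fun q => ?_⟩
  have : g ⟨0, by norm_num⟩ ≤ g q := hg (Subtype.mk_le_mk.2 q.2.1)
  linarith

/-- The decomposition is `g` and `g - f`, both raised by the same real `c₁ + c + d`: the natural
constants provide nonnegativity, and `d` avoids the rationals. -/
theorem ComputesSlopeBound.computesJordanDecomposition {B : ℕ → Bool} {f : Set.Icc (0 : ℝ) 1 → ℝ}
    (hf : IsComputableFunction f) (hbv : BoundedVariationOn f Set.univ)
    (h : ComputesSlopeBound B f) : ComputesJordanDecomposition B f := by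
  obtain ⟨g, hg, hgB, hs⟩ := h
  obtain ⟨c, hc⟩ := exists_nat_bound hbv
  obtain ⟨c₁, hc₁⟩ := exists_nat_add_nonneg hg
  have h1 : ∀ q : IQ, 0 ≤ g q + (c₁ + c : ℕ) := fun q => by
    have := hc₁ q
    push_cast
    linarith [Nat.cast_nonneg (α := ℝ) c]
  have h2 : ∀ q : IQ, 0 ≤ g q + (c₁ + c : ℕ) - (f q.toReal + c) + c := fun q => by
    have := hc₁ q
    have := (abs_le.1 (hc q.toReal)).2
    push_cast
    linarith
  have hr := NatApprox.of_computesFunction hgB (c₁ + c) h1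
  have hs' := hr.sub_add (NatApprox.of_isComputableFunction hf c fun x => by
    linarith [(abs_le.1 (hc x)).1]).of_empty c fun i => h2 _
  obtain ⟨d, hd1, hd2⟩ := exists_common_shift (g := fun q => g q + (c₁ + c : ℕ))
    (h := fun q : IQ => g q + (c₁ + c : ℕ) - (f q.toReal + c) + c) hr hs' h1 h2
  refine ⟨_, _, fun x y hxy => ?_, fun x y hxy => ?_, hd1, hd2, fun q => by ring⟩
  · have := hg hxy
    linarith
  · have := hs.monotone_sub hxy
    beta_reduce at this ⊢
    linarith

theorem ComputesJordanDecomposition.computesSlopeBound {B : ℕ → Bool}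
    {f : Set.Icc (0 : ℝ) 1 → ℝ} (h : ComputesJordanDecomposition B f) :
    ComputesSlopeBound B f := by
  obtain ⟨g, h, hg, hh, hgB, -, e⟩ := h
  refine ⟨g, hg, hgB, fun x y hxy => ?_⟩
  have := hh hxy.le
  beta_reduce
  rw [e, e]
  linarith

/-! ### From PA degree to slope bounds -/

/-- A computable family of conditions, each on two bits, defines a `Π⁰₁` class. -/
theorem isPi01Class_setOf {φ : ℕ → Bool → Bool → Prop} [∀ k x y, Decidable (φ k x y)]
    {u v : ℕ → ℕ} (hφ : ComputableIn {} fun p : ℕ × Bool × Bool => decide (φ p.1 p.2.1 p.2.2))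
    (hu : ComputableIn {} u) (hv : ComputableIn {} v) :
    IsPi01Class {X | ∀ k, φ k (X (u k)) (X (v k))} := by
  -- A string is tested only on those conditions whose two bits it already contains; long enough
  -- initial segments reach each condition.
  refine ⟨fun l => decide (∀ k < l.length, u k < l.length → v k < l.length →
    φ k (l.getD (u k) false) (l.getD (v k) false)), ?_, ?_⟩
  · refine computable ?_
    have hl : ComputableIn {} fun p : List Bool × ℕ => p.1.length :=
      .of_primrec Primrec.list_length (by fun_prop)
    have h1 : ComputableIn {} fun p : List Bool × ℕ => p.1.getD (u p.2) false :=
      .of_primrec₂ (Primrec.list_getD false) (by fun_prop) (by fun_prop)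
    have h2 : ComputableIn {} fun p : List Bool × ℕ => p.1.getD (v p.2) false :=
      .of_primrec₂ (Primrec.list_getD false) (by fun_prop) (by fun_prop)
    have h3 : ComputableIn {} fun p : List Bool × ℕ => decide
        (φ p.2 (p.1.getD (u p.2) false) (p.1.getD (v p.2) false)) :=
      ComputableIn.comp hφ (g := fun p : List Bool × ℕ =>
        (p.2, p.1.getD (u p.2) false, p.1.getD (v p.2) false)) (by fun_prop)
    exact decide_ball (of_primrec Primrec.list_length (by fun_prop))
      (decide_imp (by fun_prop) (decide_imp (by fun_prop) h3))
  · have hget : ∀ (X : ℕ → Bool) {m n : ℕ}, m < n →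
        ((List.range n).map X).getD m false = X m := fun X m n h => by simp [h]
    ext X
    simp only [Set.mem_ofPred_eq, decide_eq_true_eq, List.length_map, List.length_range]
    constructor
    · intro h n k _ h2 h3
      rw [hget X h2, hget X h3]
      exact h k
    · intro h k
      have h2 : u k < k + u k + v k + 1 := by omega
      have h3 : v k < k + u k + v k + 1 := by omega
      have := h (k + u k + v k + 1) k (by omega) h2 h3
      rwa [hget X h2, hget X h3] at this

theorem unitRat_le_unitRat_iff (i j : ℕ) : unitRat i ≤ unitRat j ↔
    min i.unpair.1 (i.unpair.2 + 1) * (j.unpair.2 + 1) ≤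
      min j.unpair.1 (j.unpair.2 + 1) * (i.unpair.2 + 1) := by
  rw [← Subtype.coe_le_coe]
  simp only [unitRat]
  rw [div_le_div_iff₀ (by positivity) (by positivity)]
  exact_mod_cast Iff.rfl

@[fun_prop]
theorem computableIn_unitRat_le {O : Set (ℕ →. ℕ)} {α : Type*} [Primcodable α] {f g : α → ℕ}
    (hf : ComputableIn O f) (hg : ComputableIn O g) :
    ComputableIn O fun a => decide (unitRat (f a) ≤ unitRat (g a)) := by
  simp only [unitRat_le_unitRat_iff]
  fun_prop

theorem le_of_forall_le_add_pow {a b c : ℝ} (h : ∀ n : ℕ, a ≤ b + c * (1 / 2) ^ n) : a ≤ b := by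
  have h1 : Filter.Tendsto (fun n : ℕ => b + c * (1 / 2 : ℝ) ^ n) Filter.atTop
      (nhds (b + c * 0)) :=
    (tendsto_pow_atTop_nhds_zero_of_lt_one (by norm_num) (by norm_num)).const_mul c |>.const_add b
  rw [mul_zero, add_zero] at h1
  exact ge_of_tendsto' h1 h

/-- Consistent approximations determine a function on `I_ℚ`. -/
theorem exists_eq_of_approx {A : ℕ → ℕ → ℕ}
    (hA : ∀ i j m n, unitRat i = unitRat j →
      ((A i m : ℝ) - 1) * (1 / 2) ^ m ≤ A j n * (1 / 2) ^ n) :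
    ∃ g : IQ → ℝ, ∀ i n, ((A i n : ℝ) - 1) * (1 / 2) ^ n ≤ g (unitRat i) ∧
      g (unitRat i) ≤ A i n * (1 / 2) ^ n := by
  refine ⟨fun q => ⨆ k : {k : ℕ × ℕ // unitRat k.1 = q}, ((A k.1.1 k.1.2 : ℝ) - 1) *
    (1 / 2) ^ k.1.2, fun i n => ⟨?_, ?_⟩⟩
  · refine le_ciSup (f := fun k : {k : ℕ × ℕ // unitRat k.1 = unitRat i} =>
      ((A k.1.1 k.1.2 : ℝ) - 1) * (1 / 2) ^ k.1.2) ⟨A i 0 * (1 / 2) ^ 0, ?_⟩ ⟨(i, n), rfl⟩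
    rintro _ ⟨k, rfl⟩
    exact hA _ _ _ _ k.2
  · have : Nonempty {k : ℕ × ℕ // unitRat k.1 = unitRat i} := ⟨⟨(i, n), rfl⟩⟩
    exact ciSup_le fun k => hA _ _ _ _ k.2

/-- The bit that says whether the `i`-th value is at most `m / 2 ^ n`. -/
def cutBit (X : ℕ → Bool) (i n m : ℕ) : Bool := X (Nat.pair i (Nat.pair n m))

/-- The condition on two such bits `x` and `y`, for the values `V i` and `V i'` of a slope bound
with values in `(0, K]`, where `a` and `a'` approximate `2 ^ t` times the values of the given
function at the same places. -/
def CutCondition (K i n m i' n' m' a a' t : ℕ) (x y : Bool) : Prop :=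
  (K * 2 ^ n ≤ m → x = true) ∧ (m = 0 → x = false) ∧
    (unitRat i ≤ unitRat i' → x = false → y = true →
      m * 2 ^ n' ≤ m' * 2 ^ n ∧ a' * 2 ^ (n + n') + 2 ^ t * (m * 2 ^ n') ≤
        2 ^ t * (m' * 2 ^ n) + 4 * 2 ^ (n + n') + a * 2 ^ (n + n'))

instance (K i n m i' n' m' a a' t : ℕ) (x y : Bool) :
    Decidable (CutCondition K i n m i' n' m' a a' t x y) := by
  unfold CutCondition
  infer_instance

@[fun_prop]
theorem computableIn_cutCondition {O : Set (ℕ →. ℕ)} {α : Type*} [Primcodable α] (K : ℕ)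
    {i n m i' n' m' a a' t : α → ℕ} {x y : α → Bool} (hi : ComputableIn O i)
    (hn : ComputableIn O n) (hm : ComputableIn O m) (hi' : ComputableIn O i')
    (hn' : ComputableIn O n') (hm' : ComputableIn O m') (ha : ComputableIn O a)
    (ha' : ComputableIn O a') (ht : ComputableIn O t) (hx : ComputableIn O x)
    (hy : ComputableIn O y) : ComputableIn O fun p => decide
      (CutCondition K (i p) (n p) (m p) (i' p) (n' p) (m' p) (a p) (a' p) (t p) (x p) (y p)) := by
  unfold CutCondition
  refine .decide_and (.decide_imp (by fun_prop) (by fun_prop))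
    (.decide_and (.decide_imp (by fun_prop) (by fun_prop)) (.decide_imp (by fun_prop)
    (.decide_imp (by fun_prop) (.decide_imp (by fun_prop) (.decide_and (by fun_prop) ?_)))))
  fun_prop

/-- Genuine slope bounds satisfy the last clause of `CutCondition`. The slack `4` absorbs the two
approximation errors of size `2`. -/
theorem cut_le_cut {n m n' m' t a a' : ℕ} {v v' r r' : ℝ} (hv : v ≤ v') (hr : r' - r ≤ v' - v)
    (ha : |2 ^ t * r - a| ≤ 2) (ha' : |2 ^ t * r' - a'| ≤ 2) (h1 : (m : ℝ) < 2 ^ n * v)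
    (h2 : 2 ^ n' * v' ≤ m') :
    m * 2 ^ n' ≤ m' * 2 ^ n ∧ a' * 2 ^ (n + n') + 2 ^ t * (m * 2 ^ n') ≤
        2 ^ t * (m' * 2 ^ n) + 4 * 2 ^ (n + n') + a * 2 ^ (n + n') := by
  rw [abs_le] at ha ha'
  suffices h : (m * 2 ^ n' : ℝ) ≤ m' * 2 ^ n ∧ (a' * 2 ^ (n + n') + 2 ^ t * (m * 2 ^ n') : ℝ) ≤
        2 ^ t * (m' * 2 ^ n) + 4 * 2 ^ (n + n') + a * 2 ^ (n + n') by exact_mod_cast h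
  rw [pow_add]
  have hp : (0 : ℝ) < 2 ^ n := by positivity
  have hq : (0 : ℝ) < 2 ^ n' := by positivity
  have hs : (0 : ℝ) < 2 ^ t := by positivity
  generalize (2 : ℝ) ^ n = p at *
  generalize (2 : ℝ) ^ n' = q at *
  generalize (2 : ℝ) ^ t = s at *
  have e1 : m * q ≤ p * q * v := by nlinarith
  have e2 : p * q * v' ≤ m' * p := by nlinarith
  have e3 : p * q * v ≤ p * q * v' := by gcongr
  have e4 := mul_le_mul_of_nonneg_left e1 hs.le
  have e5 := mul_le_mul_of_nonneg_left e2 hs.le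
  have e6 := mul_le_mul_of_nonneg_left hr (by positivity : 0 ≤ s * (p * q))
  have e7 := mul_le_mul_of_nonneg_left ha.2 (by positivity : 0 ≤ p * q)
  have e8 := mul_le_mul_of_nonneg_left ha'.1 (by positivity : 0 ≤ p * q)
  refine ⟨by linarith, by linarith⟩

/-- Conversely, the slack and the approximation errors amount to at most `8 / 2 ^ t`, which vanishes
as `t` grows. So the conditions for all `t` together give the exact inequality. -/
theorem le_of_forall_cut_le_cut {n m n' m' : ℕ} {a a' : ℕ → ℕ} {r r' : ℝ}
    (ha : ∀ t, |2 ^ t * r - a t| ≤ 2) (ha' : ∀ t, |2 ^ t * r' - a' t| ≤ 2)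
    (h : ∀ t, m * 2 ^ n' ≤ m' * 2 ^ n ∧ a' t * 2 ^ (n + n') + 2 ^ t * (m * 2 ^ n') ≤
        2 ^ t * (m' * 2 ^ n) + 4 * 2 ^ (n + n') + a t * 2 ^ (n + n')) :
    (m : ℝ) * (1 / 2) ^ n + max 0 (r' - r) ≤ m' * (1 / 2) ^ n' := by
  have hp : (0 : ℝ) < 2 ^ n := by positivity
  have hq : (0 : ℝ) < 2 ^ n' := by positivity
  simp only [one_div, inv_pow, ← div_eq_mul_inv]
  rcases max_cases 0 (r' - r) with ⟨e, -⟩ | ⟨e, -⟩ <;> rw [e]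
  · rw [add_zero, div_le_div_iff₀ hp hq]
    exact_mod_cast (h 0).1
  · refine le_of_forall_le_add_pow (c := 8) fun t => ?_
    have h1 := abs_le.1 (ha t)
    have h2 := abs_le.1 (ha' t)
    have h3 : (a' t * (2 ^ n * 2 ^ n') + 2 ^ t * (m * 2 ^ n') : ℝ) ≤
        2 ^ t * (m' * 2 ^ n) + 4 * (2 ^ n * 2 ^ n') + a t * (2 ^ n * 2 ^ n') := by
      rw [← pow_add]
      exact_mod_cast (h t).2
    have hs : (0 : ℝ) < 2 ^ t := by positivity
    simp only [one_div, inv_pow, ← div_eq_mul_inv]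
    generalize (2 : ℝ) ^ n = p at *
    generalize (2 : ℝ) ^ n' = q at *
    generalize (2 : ℝ) ^ t = s at *
    have e7 := mul_le_mul_of_nonneg_left h1.1 (by positivity : 0 ≤ p * q)
    have e8 := mul_le_mul_of_nonneg_left h2.2 (by positivity : 0 ≤ p * q)
    rw [div_add' _ _ _ hp.ne', div_add_div _ _ hq.ne' hs.ne',
      div_le_div_iff₀ hp (by positivity)]
    linarith

theorem HasPADegree.computesSlopeBound {B : ℕ → Bool} (hB : HasPADegree B)
    {f : Set.Icc (0 : ℝ) 1 → ℝ} (hf : IsComputableFunction f)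
    (hbv : BoundedVariationOn f Set.univ) : ComputesSlopeBound B f := by
  obtain ⟨c, hc⟩ := exists_nat_bound hbv
  obtain ⟨F, hFc, hF⟩ := NatApprox.of_isComputableFunction hf c fun x => by
    linarith [(abs_le.1 (hc x)).1]
  -- a slope bound exists
  have hlbv := hbv.locallyBoundedVariationOn
  -- The added `1` makes the values positive, as the clause for `m = 0` demands.
  set V : Set.Icc (0 : ℝ) 1 → ℝ := fun x => variationOnFromTo f Set.univ 0 x + 1 with hV
  have hVm : Monotone V := fun x y hxy => by
    have := variationOnFromTo.monotoneOn hlbv (Set.mem_univ 0) (Set.mem_univ x)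
      (Set.mem_univ y) hxy
    simp only [hV]
    linarith
  have hVs : ∀ x y, x ≤ y → f y - f x ≤ V y - V x := fun x y hxy => by
    have := variationOnFromTo.sub_self_monotoneOn hlbv (Set.mem_univ 0) (Set.mem_univ x)
      (Set.mem_univ y) hxy
    simp only [hV, Pi.sub_apply] at this ⊢
    linarith
  have hV1 : ∀ x, 1 ≤ V x := fun x => by
    have : V 0 ≤ V x := hVm x.2.1
    simp only [hV, variationOnFromTo.self] at this ⊢
    linarith
  obtain ⟨K, hK⟩ := exists_nat_ge (V 1)
  have hVK : ∀ x, V x ≤ K := fun x => (hVm x.2.2).trans hK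
  -- the class of all slope bounds with values in `[0, K]`
  set P : Set (ℕ → Bool) := {X | ∀ i n m i' n' m' t,
    CutCondition K i n m i' n' m' (F i t) (F i' t) t (cutBit X i n m) (cutBit X i' n' m')} with hP
  have hPclass : IsPi01Class P := by
    have hFc' : ∀ {α : Type} [Primcodable α] {a b : α → ℕ}, ComputableIn {} a →
        ComputableIn {} b → ComputableIn {} fun p => F (a p) (b p) := fun ha hb =>
      ComputableIn.comp hFc (ComputableIn.pair ha hb)
    have := isPi01Class_setOf (φ := fun k x y => CutCondition K k.unpair.1 k.unpair.2.unpair.1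
      k.unpair.2.unpair.2.unpair.1 k.unpair.2.unpair.2.unpair.2.unpair.1
      k.unpair.2.unpair.2.unpair.2.unpair.2.unpair.1
      k.unpair.2.unpair.2.unpair.2.unpair.2.unpair.2.unpair.1
      (F k.unpair.1 k.unpair.2.unpair.2.unpair.2.unpair.2.unpair.2.unpair.2)
      (F k.unpair.2.unpair.2.unpair.2.unpair.1
        k.unpair.2.unpair.2.unpair.2.unpair.2.unpair.2.unpair.2)
      k.unpair.2.unpair.2.unpair.2.unpair.2.unpair.2.unpair.2 x y)
      (u := fun k => Nat.pair k.unpair.1 (Nat.pair k.unpair.2.unpair.1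
        k.unpair.2.unpair.2.unpair.1))
      (v := fun k => Nat.pair k.unpair.2.unpair.2.unpair.2.unpair.1
        (Nat.pair k.unpair.2.unpair.2.unpair.2.unpair.2.unpair.1
        k.unpair.2.unpair.2.unpair.2.unpair.2.unpair.2.unpair.1))
      (computableIn_cutCondition K (by fun_prop) (by fun_prop) (by fun_prop) (by fun_prop)
        (by fun_prop) (by fun_prop) (hFc' (by fun_prop) (by fun_prop))
        (hFc' (by fun_prop) (by fun_prop)) (by fun_prop) (by fun_prop) (by fun_prop))
      (by fun_prop) (by fun_prop)
    convert this using 1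
    ext X
    simp only [hP, Set.mem_ofPred_eq, cutBit]
    refine ⟨fun h k => h _ _ _ _ _ _ _, fun h i n m i' n' m' t => ?_⟩
    simpa using h (Nat.pair i (Nat.pair n (Nat.pair m (Nat.pair i' (Nat.pair n'
        (Nat.pair m' t))))))
  have hPne : P.Nonempty := by
    refine ⟨fun k => decide (2 ^ k.unpair.2.unpair.1 * V (unitRat k.unpair.1).toReal ≤
      k.unpair.2.unpair.2), ?_⟩
    intro i n m i' n' m' t
    simp only [CutCondition, cutBit, Nat.unpair_pair, decide_eq_true_eq, decide_eq_false_iff_not, not_le]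
    refine ⟨fun h => ?_, fun h => ?_, fun h1 h2 h3 => ?_⟩
    · have : (K : ℝ) * 2 ^ n ≤ m := by exact_mod_cast h
      refine le_trans ?_ this
      rw [mul_comm]
      exact mul_le_mul_of_nonneg_right (hVK _) (by positivity)
    · subst h
      have := hV1 (unitRat i).toReal
      push_cast
      positivity
    · have hle := IQ.toReal_mono h1
      refine cut_le_cut (hVm hle) ?_ (hF i t) (hF i' t) h2 h3
      linarith [hVs _ _ hle]
  obtain ⟨X, hX, hXB⟩ := hB P hPclass hPne
  have hex : ∀ p : ℕ × ℕ, ∃ m, cutBit X p.1 p.2 m = true := fun p =>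
    ⟨K * 2 ^ p.2, (hX p.1 p.2 (K * 2 ^ p.2) 0 0 0 0).1 le_rfl⟩
  -- The bits of `X` need not be monotone in `m`. It is enough that the bit at the least positive
  -- answer `A i n` is true and the one just before it is false.
  set A : ℕ → ℕ → ℕ := fun i n => Nat.find (hex (i, n)) with hA
  have hAc : ComputableIn (oracle B) fun p : ℕ × ℕ => A p.1 p.2 := by
    refine find (p := fun (p : ℕ × ℕ) m => cutBit X p.1 p.2 m = true) (.decide_eq_true' ?_) hex
    exact ComputableIn.comp hXB
      (g := fun q : (ℕ × ℕ) × ℕ => Nat.pair q.1.1 (Nat.pair q.1.2 q.2)) (by fun_prop)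
  have hA1 : ∀ i n, 1 ≤ A i n := fun i n => by
    by_contra h
    have h0 : A i n = 0 := by omega
    have h1 : cutBit X i n (A i n) = true := Nat.find_spec (hex (i, n))
    have h2 := (hX i n (A i n) 0 0 0 0).2.1 h0
    rw [h1] at h2
    cases h2
  have hAA : ∀ i i' n n', unitRat i ≤ unitRat i' →
      ((A i n : ℝ) - 1) * (1 / 2) ^ n + max 0 (f (unitRat i').toReal - f (unitRat i).toReal) ≤
        A i' n' * (1 / 2) ^ n' := by
    intro i i' n n' h
    have h1 : cutBit X i n (A i n - 1) = false := by
      have := Nat.find_min (hex (i, n)) (m := A i n - 1) (Nat.sub_one_lt (Nat.one_le_iff_ne_zero.1 (hA1 i n)))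
      simpa using this
    have h2 : cutBit X i' n' (A i' n') = true := Nat.find_spec (hex (i', n'))
    have h3 := fun t => (hX i n (A i n - 1) i' n' (A i' n') t).2.2 h h1 h2
    have h4 : ((A i n - 1 : ℕ) : ℝ) = A i n - 1 := by
      rw [Nat.cast_sub (hA1 i n)]
      simp
    rw [← h4]
    have := le_of_forall_cut_le_cut (hF i) (hF i') h3
    rwa [add_sub_add_right_eq_sub] at this
  obtain ⟨g, hg⟩ := exists_eq_of_approx (A := A) fun i j m n h =>
    (le_add_of_nonneg_right (le_max_left _ _)).trans (hAA i j m n h.le)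
  have hgs : ∀ q q' : IQ, q ≤ q' → max 0 (f q'.toReal - f q.toReal) ≤ g q' - g q := by
    intro q q' h
    obtain ⟨i, rfl⟩ := unitRat_surjective q
    obtain ⟨i', rfl⟩ := unitRat_surjective q'
    -- Each of the two values is known up to `2 ^ (-n)`.
    refine le_of_forall_le_add_pow (c := 2) fun n => ?_
    have h1 := (hg i n).2
    have h2 := (hg i' n).1
    have h3 := hAA i i' n n h
    linarith
  have hg0 : ∀ q, 0 ≤ g q := fun q => by
    obtain ⟨i, rfl⟩ := unitRat_surjective q
    refine le_trans ?_ (hg i 0).1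
    have : (1 : ℝ) ≤ A i 0 := by exact_mod_cast hA1 i 0
    simpa using this
  have hga : NatApprox (oracle B) fun i => g (unitRat i) := by
    refine ⟨A, hAc, fun i n => ?_⟩
    obtain ⟨h1, h2⟩ := hg i n
    have e : (2 : ℝ) ^ n * (1 / 2) ^ n = 1 := by rw [← mul_pow]; norm_num
    have h3 := mul_le_mul_of_nonneg_left h1 (pow_nonneg zero_le_two n)
    have h4 := mul_le_mul_of_nonneg_left h2 (pow_nonneg zero_le_two n)
    rw [mul_left_comm, e, mul_one] at h3 h4
    rw [abs_le]
    constructor <;> linarith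
  obtain ⟨d, hd, -⟩ := exists_common_shift hga hga hg0 hg0
  refine ⟨_, fun x y hxy => ?_, hd, fun x y hxy => ?_⟩
  · have := (le_max_left _ _).trans (hgs x y hxy)
    linarith
  · have := (le_max_right _ _).trans (hgs x y hxy.le)
    linarith

/-! ### Binary trees, extendible nodes and paths -/

/-- Binary trees: the number `c < 2 ^ n` stands for the string of its `n` binary digits, so that
`c / 2` is the parent of `c`. -/
structure IsTree (T : ℕ → ℕ → Prop) : Prop where
  lt {n c : ℕ} : T n c → c < 2 ^ n
  parent {n c : ℕ} : T (n + 1) c → T n (c / 2)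

theorem IsTree.ancestor {T : ℕ → ℕ → Prop} (hT : IsTree T) {n c : ℕ} (k : ℕ)
    (h : T (n + k) c) : T n (c / 2 ^ k) := by
  induction k generalizing c with
  | zero => simpa using h
  | succ k ih =>
    have := ih (hT.parent h)
    rwa [Nat.div_div_eq_div_mul, ← pow_succ'] at this

/-- The node `c` of level `n` has descendants at all later levels. -/
def Extendible (T : ℕ → ℕ → Prop) (n c : ℕ) : Prop :=
  ∀ k, ∃ e, T (n + k) e ∧ e / 2 ^ k = c

theorem Extendible.mem {T : ℕ → ℕ → Prop} {n c : ℕ} (h : Extendible T n c) : T n c := by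
  obtain ⟨e, he, rfl⟩ := h 0
  simpa using he

theorem IsTree.descendant_of_le {T : ℕ → ℕ → Prop} (hT : IsTree T) {n c k k' : ℕ} (hk : k ≤ k')
    (h : ∃ e, T (n + k') e ∧ e / 2 ^ k' = c) : ∃ e, T (n + k) e ∧ e / 2 ^ k = c := by
  obtain ⟨m, rfl⟩ := Nat.exists_eq_add_of_le hk
  obtain ⟨e, he, rfl⟩ := h
  refine ⟨e / 2 ^ m, hT.ancestor m (by rwa [add_assoc]), ?_⟩
  rw [Nat.div_div_eq_div_mul, ← pow_add, add_comm]

/-- If the left child has no descendants `k₀` levels below it, every descendant of `c` at least that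
deep passes through the right child. -/
theorem IsTree.extendible_child {T : ℕ → ℕ → Prop} (hT : IsTree T) {n c : ℕ}
    (h : Extendible T n c) (h0 : ¬ Extendible T (n + 1) (2 * c)) :
    Extendible T (n + 1) (2 * c + 1) := by
  intro k
  simp only [Extendible, not_forall] at h0
  obtain ⟨k₀, hk₀⟩ := h0
  obtain ⟨e, he, hec⟩ := h (max k k₀ + 1)
  rw [show n + (max k k₀ + 1) = n + 1 + max k k₀ by ring] at he
  rw [pow_succ, ← Nat.div_div_eq_div_mul] at hec
  have hne : e / 2 ^ max k k₀ ≠ 2 * c := fun h =>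
    hk₀ (hT.descendant_of_le (le_max_right _ _) ⟨e, he, h⟩)
  exact hT.descendant_of_le (le_max_left _ _) ⟨e, he, by omega⟩

/-- The path through the extendible nodes of a tree that goes left whenever possible, where `ext`
tells which nodes are extendible. -/
def leftPath (ext : ℕ → ℕ → Bool) (n : ℕ) : ℕ :=
  Nat.rec 0 (fun n c => if ext (n + 1) (2 * c) = true then 2 * c else 2 * c + 1) n

theorem leftPath_succ (ext : ℕ → ℕ → Bool) (n : ℕ) : leftPath ext (n + 1) =
    if ext (n + 1) (2 * leftPath ext n) = true then 2 * leftPath ext n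
    else 2 * leftPath ext n + 1 := rfl

theorem leftPath_succ_div (ext : ℕ → ℕ → Bool) (n : ℕ) :
    leftPath ext (n + 1) / 2 = leftPath ext n := by
  rw [leftPath_succ]
  split_ifs <;> omega

theorem computableIn_leftPath {O : Set (ℕ →. ℕ)} {ext : ℕ → ℕ → Bool}
    (h : ComputableIn O fun p : ℕ × ℕ => ext p.1 p.2) : ComputableIn O (leftPath ext) := by
  refine of_succ (h := fun p => if ext (p.1 + 1) (2 * p.2) = true then 2 * p.2 else 2 * p.2 + 1)
    ?_ (leftPath_succ ext)
  have := ComputableIn.comp h (g := fun p : ℕ × ℕ => (p.1 + 1, 2 * p.2)) (by fun_prop)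
  simp only at this
  fun_prop

theorem IsTree.extendible_leftPath {T : ℕ → ℕ → Prop} (hT : IsTree T) (hne : ∀ n, ∃ c, T n c)
    {ext : ℕ → ℕ → Bool} (hext : ∀ n c, ext n c = true ↔ Extendible T n c) (n : ℕ) :
    Extendible T n (leftPath ext n) := by
  induction n with
  | zero =>
    intro k
    obtain ⟨c, hc⟩ := hne k
    exact ⟨c, by rwa [zero_add], Nat.div_eq_of_lt (hT.lt hc)⟩
  | succ n ih =>
    rw [leftPath_succ]
    split_ifs with h
    · exact (hext _ _).1 h
    · exact hT.extendible_child ih (mt (hext _ _).2 h)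

theorem path_div {C : ℕ → ℕ} (hC : ∀ n, C (n + 1) / 2 = C n) (n k : ℕ) :
    C (n + k) / 2 ^ k = C n := by
  induction k with
  | zero => simp
  | succ k ih => rw [pow_succ', ← Nat.div_div_eq_div_mul, ← add_assoc, hC, ih]

/-- The string of the `n` last binary digits of `c`. -/
def digits (n c : ℕ) : List Bool :=
  (List.range n).map fun j => decide (c / 2 ^ (n - (j + 1)) % 2 = 1)

theorem digits_path {C : ℕ → ℕ} (hC : ∀ n, C (n + 1) / 2 = C n) (n : ℕ) :
    digits n (C n) = (List.range n).map fun j => decide (C (j + 1) % 2 = 1) := by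
  refine List.map_congr_left fun j hj => ?_
  have hj : j < n := List.mem_range.1 hj
  have := path_div hC (j + 1) (n - (j + 1))
  rw [Nat.add_sub_cancel' hj] at this
  rw [this]

/-- The members of a `Π⁰₁` class are the paths through a computable tree. -/
theorem IsPi01Class.exists_tree {P : Set (ℕ → Bool)} (hP : IsPi01Class P) (hne : P.Nonempty) :
    ∃ T : ℕ → ℕ → Bool, ComputableIn {} (fun p : ℕ × ℕ => T p.1 p.2) ∧
      IsTree (fun n c => T n c = true) ∧ (∀ n, ∃ c, T n c = true) ∧
      ∀ C : ℕ → ℕ, (∀ n, C (n + 1) / 2 = C n) → (∀ n, T n (C n) = true) →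
        (fun n => decide (C (n + 1) % 2 = 1)) ∈ P := by
  obtain ⟨R, hR, rfl⟩ := hP
  -- All initial segments are tested, not only the whole string, so that parents of nodes are nodes.
  refine ⟨fun n c => decide (c < 2 ^ n ∧ ∀ k < n + 1, R (digits k (c / 2 ^ (n - k))) = true),
    ?_, ⟨?_, ?_⟩, ?_, ?_⟩
  · have hd : ComputableIn {} fun q : (ℕ × ℕ) × ℕ => digits q.2 (q.1.2 / 2 ^ (q.1.1 - q.2)) :=
      list_map_range (n := fun q : (ℕ × ℕ) × ℕ => q.2) (f := fun q j =>
        decide (q.1.2 / 2 ^ (q.1.1 - q.2) / 2 ^ (q.2 - (j + 1)) % 2 = 1)) (by fun_prop)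
        (by fun_prop)
    have hR' : ComputableIn {} R := .of_computable hR
    fun_prop
  · intro n c h
    exact (of_decide_eq_true h).1
  · intro n c h
    obtain ⟨h1, h2⟩ := of_decide_eq_true h
    refine decide_eq_true ⟨by rw [pow_succ] at h1; omega, fun k hk => ?_⟩
    have := h2 k (by omega)
    rwa [show n + 1 - k = n - k + 1 by omega, pow_succ', ← Nat.div_div_eq_div_mul] at this
  · obtain ⟨X, hX⟩ := hne
    set C : ℕ → ℕ := fun n => Nat.rec 0 (fun n c => 2 * c + (X n).toNat) n with hCdef
    have hCs : ∀ n, C (n + 1) = 2 * C n + (X n).toNat := fun n => rfl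
    have hle : ∀ n, (X n).toNat ≤ 1 := fun n => Bool.toNat_le _
    have hC : ∀ n, C (n + 1) / 2 = C n := fun n => by
      have := hle n
      rw [hCs]
      omega
    have hCX : ∀ n, decide (C (n + 1) % 2 = 1) = X n := fun n => by
      rw [hCs]
      cases X n <;> simp [Nat.add_mod]
    refine fun n => ⟨C n, decide_eq_true ⟨?_, fun k hk => ?_⟩⟩
    · induction n with
      | zero => simp [hCdef]
      | succ n ih =>
        have := hle n
        rw [hCs, pow_succ]
        omega
    · have := path_div hC k (n - k)
      rw [Nat.add_sub_cancel' (by omega)] at this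
      rw [this, digits_path hC]
      simp only [hCX]
      exact hX k
  · intro C hC h n
    have := (of_decide_eq_true (h n)).2 n (by omega)
    rw [Nat.sub_self, pow_zero, Nat.div_one, digits_path hC] at this
    exact this

/-- The node that `b` codes has no descendants at level `s`. -/
def IsDead (T : ℕ → ℕ → Bool) (b s : ℕ) : Prop :=
  b.unpair.1 ≤ s ∧ ∀ e < 2 ^ s, T s e = true → ¬ e / 2 ^ (s - b.unpair.1) = b.unpair.2

instance (T : ℕ → ℕ → Bool) (b s : ℕ) : Decidable (IsDead T b s) := by
  unfold IsDead
  infer_instance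

/-- The first level at which the node that `b` codes has no descendants is `s`. -/
def Dies (T : ℕ → ℕ → Bool) (b s : ℕ) : Prop :=
  IsDead T b s ∧ ∀ s' < s, ¬ IsDead T b s'

instance (T : ℕ → ℕ → Bool) (b s : ℕ) : Decidable (Dies T b s) := by
  unfold Dies
  infer_instance

theorem Dies.unique {T : ℕ → ℕ → Bool} {b s s' : ℕ} (h : Dies T b s) (h' : Dies T b s') :
    s = s' := by
  rcases lt_trichotomy s s' with hlt | rfl | hlt
  · exact absurd h.1 (h'.2 s hlt)
  · rfl
  · exact absurd h'.1 (h.2 s' hlt)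

theorem computableIn_isDead {O : Set (ℕ →. ℕ)} {α : Type*} [Primcodable α] {T : ℕ → ℕ → Bool}
    (hT : ComputableIn O fun p : ℕ × ℕ => T p.1 p.2) {b s : α → ℕ} (hb : ComputableIn O b)
    (hs : ComputableIn O s) : ComputableIn O fun a => decide (IsDead T (b a) (s a)) := by
  unfold IsDead
  have h : ComputableIn O fun q : α × ℕ => T (s q.1) q.2 :=
    ComputableIn.comp hT (g := fun q : α × ℕ => (s q.1, q.2)) (by fun_prop)
  exact .decide_and (by fun_prop) (decide_ball (by fun_prop)
    (.decide_imp (by fun_prop) (by fun_prop)))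

theorem computableIn_dies {O : Set (ℕ →. ℕ)} {α : Type*} [Primcodable α] {T : ℕ → ℕ → Bool}
    (hT : ComputableIn O fun p : ℕ × ℕ => T p.1 p.2) {b s : α → ℕ} (hb : ComputableIn O b)
    (hs : ComputableIn O s) : ComputableIn O fun a => decide (Dies T (b a) (s a)) := by
  unfold Dies
  exact .decide_and (computableIn_isDead hT hb hs) (decide_ball hs
    (.decide_not (computableIn_isDead hT (by fun_prop) (by fun_prop))))

theorem isDead_iff {T : ℕ → ℕ → Bool} (hT : IsTree fun n c => T n c = true) {n c k : ℕ} :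
    IsDead T (Nat.pair n c) (n + k) ↔ ¬ ∃ e, T (n + k) e = true ∧ e / 2 ^ k = c := by
  simp only [IsDead, Nat.unpair_pair, Nat.add_sub_cancel_left, not_exists, not_and]
  exact ⟨fun h e he => h.2 e (hT.lt he) he, fun h => ⟨Nat.le_add_right _ _, fun e _ => h e⟩⟩

theorem extendible_iff {T : ℕ → ℕ → Bool} (hT : IsTree fun n c => T n c = true) {n c : ℕ} :
    Extendible (fun n c => T n c = true) n c ↔ ∀ s, ¬ IsDead T (Nat.pair n c) s := by
  constructor
  · intro h s hs
    have hns : n ≤ s := by simpa using hs.1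
    obtain ⟨k, rfl⟩ := Nat.exists_eq_add_of_le hns
    exact (isDead_iff hT).1 hs (h k)
  · intro h k
    exact not_not.1 (mt (isDead_iff hT).2 (h (n + k)))

theorem IsDead.mono {T : ℕ → ℕ → Bool} (hT : IsTree fun n c => T n c = true) {b s s' : ℕ}
    (h : IsDead T b s) (hs : s ≤ s') : IsDead T b s' := by
  rw [← Nat.pair_unpair b] at h ⊢
  have h1 : b.unpair.1 ≤ s := by simpa using h.1
  obtain ⟨k, rfl⟩ := Nat.exists_eq_add_of_le h1
  obtain ⟨k', rfl⟩ := Nat.exists_eq_add_of_le hs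
  rw [isDead_iff hT] at h
  rw [add_assoc, isDead_iff hT]
  exact mt (hT.descendant_of_le (Nat.le_add_right _ _)) h

/-- A computable bound for the levels at which nodes die yields a computable path. -/
theorem exists_path_of_dies_lt {O : Set (ℕ →. ℕ)} {T : ℕ → ℕ → Bool}
    (hTc : ComputableIn O fun p : ℕ × ℕ => T p.1 p.2) (hT : IsTree fun n c => T n c = true)
    (hne : ∀ n, ∃ c, T n c = true) {d : ℕ → ℕ} (hd : ComputableIn O d)
    (hds : ∀ b s, Dies T b s → s ≤ d b) :
    ∃ C : ℕ → ℕ, ComputableIn O C ∧ (∀ n, C (n + 1) / 2 = C n) ∧ ∀ n, T n (C n) = true := by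
  -- Being dead persists, so a node that ever dies is dead at the bound `d`; extendibility thus
  -- reduces to one decidable question.
  set ext : ℕ → ℕ → Bool := fun n c => decide (¬ IsDead T (Nat.pair n c) (d (Nat.pair n c)))
  refine ⟨leftPath ext, computableIn_leftPath ?_, leftPath_succ_div ext, fun n =>
    (hT.extendible_leftPath hne (fun n c => ?_) n).mem⟩
  · exact .decide_not (computableIn_isDead hTc (by fun_prop) (by fun_prop))
  · rw [extendible_iff hT, decide_eq_true_eq]
    refine ⟨fun h s hs => h ?_, fun h => h _⟩
    classical
    have hex : ∃ s, IsDead T (Nat.pair n c) s := ⟨s, hs⟩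
    have hdies : Dies T (Nat.pair n c) (Nat.find hex) :=
      ⟨Nat.find_spec hex, fun s' h' => Nat.find_min hex h'⟩
    exact hdies.1.mono hT (hds _ _ hdies)

/-- König's lemma. -/
theorem IsTree.exists_path {S : ℕ → ℕ → Prop} (hS : IsTree S) (hne : ∀ n, ∃ c, S n c) :
    ∃ C : ℕ → ℕ, (∀ n, C (n + 1) / 2 = C n) ∧ ∀ n, S n (C n) := by
  classical
  exact ⟨leftPath fun n c => decide (Extendible S n c), leftPath_succ_div _, fun n =>
    (hS.extendible_leftPath hne (fun n c => decide_eq_true_iff) n).mem⟩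

/-! ### Paths from the increments of a nondecreasing function -/

/-- Values `v n c` of a nondecreasing function at the dyadic points `c / 2 ^ n`. -/
structure IsDyadic (v : ℕ → ℕ → ℝ) : Prop where
  mono (n : ℕ) : Monotone (v n)
  double (n c : ℕ) : v (n + 1) (2 * c) = v n c

theorem IsDyadic.double_succ {v : ℕ → ℕ → ℝ} (hv : IsDyadic v) (n c : ℕ) :
    v (n + 1) (2 * c + 2) = v n (c + 1) := hv.double n (c + 1)

theorem IsDyadic.increment_le {v : ℕ → ℕ → ℝ} (hv : IsDyadic v) (n c : ℕ) :
    v (n + 1) (c + 1) - v (n + 1) c ≤ v n (c / 2 + 1) - v n (c / 2) := by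
  rw [← hv.double_succ n (c / 2), ← hv.double n (c / 2)]
  have h1 : v (n + 1) (2 * (c / 2)) ≤ v (n + 1) c := hv.mono _ (by omega)
  have h2 : v (n + 1) (c + 1) ≤ v (n + 1) (2 * (c / 2) + 2) := hv.mono _ (by omega)
  linarith

theorem IsDyadic.increment_le_pow {v : ℕ → ℕ → ℝ} (hv : IsDyadic v) (n k c : ℕ) :
    v (n + k) (c + 1) - v (n + k) c ≤ v n (c / 2 ^ k + 1) - v n (c / 2 ^ k) := by
  induction k generalizing c with
  | zero => simp
  | succ k ih =>
    refine (hv.increment_le _ _).trans ((ih _).trans_eq ?_)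
    rw [Nat.div_div_eq_div_mul, ← pow_succ']

/-- Natural numbers `A n c t` that are the integer parts of `2 ^ t * (v n c + a)`. -/
def IsFloor (v : ℕ → ℕ → ℝ) (A : ℕ → ℕ → ℕ → ℕ) (a : ℝ) : Prop :=
  ∀ n c t, (A n c t : ℝ) ≤ 2 ^ t * (v n c + a) ∧ 2 ^ t * (v n c + a) < A n c t + 1

/-- A path through large increments is computable. -/
theorem exists_path_of_increments {O : Set (ℕ →. ℕ)} {T : ℕ → ℕ → Bool}
    (hT : IsTree fun n c => T n c = true) {v : ℕ → ℕ → ℝ} (hv : IsDyadic v)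
    {A : ℕ → ℕ → ℕ → ℕ} (hA : ComputableIn O fun p : ℕ × ℕ × ℕ => A p.1 p.2.1 p.2.2) {a : ℝ}
    (hAv : IsFloor v A a) {δ : ℝ} (hδ : 0 < δ)
    (hne : ∀ n, ∃ c, T n c = true ∧ δ ≤ v n (c + 1) - v n c) :
    ∃ C : ℕ → ℕ, ComputableIn O C ∧ (∀ n, C (n + 1) / 2 = C n) ∧ ∀ n, T n (C n) = true := by
  have hS : IsTree fun n c => T n c = true ∧ δ ≤ v n (c + 1) - v n c :=
    ⟨fun h => hT.lt h.1, fun h => ⟨hT.parent h.1, h.2.trans (hv.increment_le _ _)⟩⟩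
  obtain ⟨C, hC, hCS⟩ := hS.exists_path hne
  set w : ℕ → ℝ := fun n => v n (C n + 1) - v n (C n) with hw
  have hbdd : BddBelow (Set.range w) := ⟨δ, by rintro _ ⟨n, rfl⟩; exact (hCS n).2⟩
  have hm : ∀ n, (⨅ n, w n) ≤ w n := fun n => ciInf_le hbdd n
  have hpos : 0 < ⨅ n, w n := hδ.trans_le (le_ciInf fun n => (hCS n).2)
  set μ := ⨅ n, w n with hμ
  have hw' : Antitone w := antitone_nat_of_succ_le fun n => by
    have := hv.increment_le n (C (n + 1))
    rwa [hC] at this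
  -- Increments along the path decrease to `μ > 0`. Below `d₀` the child on the path keeps at least
  -- `μ` of an increment less than `3 * μ / 2`, leaving less than `μ / 2` to its sibling.
  obtain ⟨d₀, hd₀⟩ := exists_lt_of_ciInf_lt (show ⨅ n, w n < μ + μ / 2 by linarith)
  obtain ⟨t, ht⟩ := pow_unbounded_of_one_lt (4 / μ) (one_lt_two (α := ℝ))
  rw [div_lt_iff₀ hpos] at ht
  -- The test asks whether the right half has the larger increment. The halves differ by at least `μ
  -- / 2`, and `2 ^ t * (μ / 2) > 2` outweighs the rounding. Only the finite data `d₀`, `t` and `C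
  -- d₀` are nonuniform.
  have hstep : ∀ k, C (d₀ + (k + 1)) = if 2 * A (d₀ + k + 1) (2 * C (d₀ + k) + 1) t <
      A (d₀ + k + 1) (2 * C (d₀ + k) + 2) t + A (d₀ + k + 1) (2 * C (d₀ + k)) t
      then 2 * C (d₀ + k) + 1 else 2 * C (d₀ + k) := by
    intro k
    set d := d₀ + k
    have h1 : w d < μ + μ / 2 := (hw' (Nat.le_add_right _ _)).trans_lt hd₀
    have h2 := hm (d + 1)
    have h3 := hC d
    obtain ⟨l1, l2⟩ := hAv (d + 1) (2 * C d) t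
    obtain ⟨m1, m2⟩ := hAv (d + 1) (2 * C d + 1) t
    obtain ⟨r1, r2⟩ := hAv (d + 1) (2 * C d + 2) t
    have e1 : w d = v (d + 1) (2 * C d + 2) - v (d + 1) (2 * C d) := by
      rw [hv.double, hv.double_succ]
    have ht0 : (0 : ℝ) < 2 ^ t := by positivity
    rw [← add_assoc]
    rcases Nat.even_or_odd' (C (d + 1)) with ⟨x, hx | hx⟩
    · have hx' : C (d + 1) = 2 * C d := by omega
      rw [if_neg, hx']
      have e2 : w (d + 1) = v (d + 1) (2 * C d + 1) - v (d + 1) (2 * C d) := by rw [hw, ← hx']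
      rw [not_lt, ← Nat.cast_le (α := ℝ)]
      push_cast
      have : μ / 2 ≤ 2 * v (d + 1) (2 * C d + 1) - v (d + 1) (2 * C d + 2) -
        v (d + 1) (2 * C d) := by linarith
      have := mul_le_mul_of_nonneg_left this ht0.le
      linarith
    · have hx' : C (d + 1) = 2 * C d + 1 := by omega
      rw [if_pos, hx']
      have e2 : w (d + 1) = v (d + 1) (2 * C d + 2) - v (d + 1) (2 * C d + 1) := by
        simp only [hw, hx', add_assoc, Nat.reduceAdd]
      rw [← Nat.cast_lt (α := ℝ)]
      push_cast
      have : μ / 2 ≤ v (d + 1) (2 * C d + 2) + v (d + 1) (2 * C d) -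
        2 * v (d + 1) (2 * C d + 1) := by linarith
      have := mul_le_mul_of_nonneg_left this ht0.le
      linarith
  refine ⟨C, ?_, hC, fun n => (hCS n).1⟩
  have hF : ComputableIn O fun k => C (d₀ + k) := by
    refine of_succ (h := fun p => if 2 * A (d₀ + p.1 + 1) (2 * p.2 + 1) t <
      A (d₀ + p.1 + 1) (2 * p.2 + 2) t + A (d₀ + p.1 + 1) (2 * p.2) t
      then 2 * p.2 + 1 else 2 * p.2) ?_ hstep
    have h1 := ComputableIn.comp hA
      (g := fun p : ℕ × ℕ => (d₀ + p.1 + 1, 2 * p.2, t)) (by fun_prop)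
    have h2 := ComputableIn.comp hA
      (g := fun p : ℕ × ℕ => (d₀ + p.1 + 1, 2 * p.2 + 1, t)) (by fun_prop)
    have h3 := ComputableIn.comp hA
      (g := fun p : ℕ × ℕ => (d₀ + p.1 + 1, 2 * p.2 + 2, t)) (by fun_prop)
    simp only at h1 h2 h3
    fun_prop
  exact (hF.nat_div (const' (2 ^ d₀))).of_eq fun n => by rw [add_comm d₀, path_div hC]

/-- If the death of each node, with code `b`, forces an increment `2 ^ (-b)` of `v b` at some node of the
tree, then integer parts of the values of `v` compute a path. -/
theorem exists_path_of_dies_increment {O : Set (ℕ →. ℕ)} {T : ℕ → ℕ → Bool}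
    (hTc : ComputableIn O fun p : ℕ × ℕ => T p.1 p.2) (hT : IsTree fun n c => T n c = true)
    (hne : ∀ n, ∃ c, T n c = true) {v : ℕ → ℕ → ℕ → ℝ} (hv : ∀ b, IsDyadic (v b))
    {A : ℕ → ℕ → ℕ → ℕ → ℕ}
    (hA : ComputableIn O fun p : ℕ × ℕ × ℕ × ℕ => A p.1 p.2.1 p.2.2.1 p.2.2.2) {a : ℝ}
    (hAv : ∀ b, IsFloor (v b) (A b) a)
    (hdies : ∀ b s, Dies T b s →
      ∃ c, T s c = true ∧ 1 ≤ 2 ^ b * (v b s (c + 1) - v b s c)) :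
    ∃ C : ℕ → ℕ, ComputableIn O C ∧ (∀ n, C (n + 1) / 2 = C n) ∧ ∀ n, T n (C n) = true := by
  -- At precision `b + 2` an increment of `2 ^ (-b)` becomes `4`, which forces a difference of
  -- integer parts greater than `3`, that is, at least `4`.
  by_cases h : ∀ b, ∃ d, ∀ c < 2 ^ d, ¬ (T d c = true ∧ A b d c (b + 2) + 4 ≤ A b d (c + 1) (b + 2))
  · obtain ⟨d, hdc, hd⟩ : ∃ d : ℕ → ℕ, ComputableIn O d ∧ ∀ b, ∀ c < 2 ^ d b,
        ¬ (T (d b) c = true ∧ A b (d b) c (b + 2) + 4 ≤ A b (d b) (c + 1) (b + 2)) := by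
      refine ⟨fun b => Nat.find (h b), find (p := fun b d => ∀ c < 2 ^ d,
        ¬ (T d c = true ∧ A b d c (b + 2) + 4 ≤ A b d (c + 1) (b + 2))) ?_ h,
        fun b => Nat.find_spec (h b)⟩
      have h1 := ComputableIn.comp hA (g := fun q : (ℕ × ℕ) × ℕ =>
        (q.1.1, q.1.2, q.2, q.1.1 + 2)) (by fun_prop)
      have h2 := ComputableIn.comp hA (g := fun q : (ℕ × ℕ) × ℕ =>
        (q.1.1, q.1.2, q.2 + 1, q.1.1 + 2)) (by fun_prop)
      have h3 := ComputableIn.comp hTc (g := fun q : (ℕ × ℕ) × ℕ => (q.1.2, q.2)) (by fun_prop)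
      simp only at h1 h2 h3
      exact decide_ball (by fun_prop) (by fun_prop)
    refine exists_path_of_dies_lt hTc hT hne hdc fun b s hs => ?_
    by_contra! hlt
    obtain ⟨c, hc, hinc⟩ := hdies b s hs
    obtain ⟨k, rfl⟩ := Nat.exists_eq_add_of_le hlt.le
    -- Had `b` died after level `d b`, the increment at `c` would be inherited by the ancestor of
    -- `c` at that level, where no node has one.
    have hc' := hT.ancestor k hc
    refine hd b _ (hT.lt hc') ⟨hc', ?_⟩
    have h1 := (hv b).increment_le_pow (d b) k c
    have h2 := (hAv b (d b) (c / 2 ^ k) (b + 2)).1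
    have h3 := (hAv b (d b) (c / 2 ^ k + 1) (b + 2)).2
    have h4 := mul_le_mul_of_nonneg_left h1 (pow_nonneg (zero_le_two (α := ℝ)) b)
    rw [pow_add] at h2 h3
    have : (A b (d b) (c / 2 ^ k) (b + 2) : ℝ) + 3 <
      A b (d b) (c / 2 ^ k + 1) (b + 2) := by linarith
    have : A b (d b) (c / 2 ^ k) (b + 2) + 3 <
      A b (d b) (c / 2 ^ k + 1) (b + 2) := by exact_mod_cast this
    omega
  · push Not at h
    obtain ⟨b, hb⟩ := h
    have hA' : ComputableIn O fun p : ℕ × ℕ × ℕ => A b p.1 p.2.1 p.2.2 :=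
      ComputableIn.comp hA (g := fun p : ℕ × ℕ × ℕ => (b, p.1, p.2.1, p.2.2)) (by fun_prop)
    -- A difference of `4` between integer parts guarantees only an increment above `3 / 2 ^ (b +
    -- 2)`.
    refine exists_path_of_increments hT (hv b) hA' (hAv b) (δ := 3 / 2 ^ (b + 2))
      (by positivity) fun n => ?_
    obtain ⟨c, -, hc, hcA⟩ := hb n
    refine ⟨c, hc, ?_⟩
    have h2 := (hAv b n c (b + 2)).2
    have h3 := (hAv b n (c + 1) (b + 2)).1
    have h4 : (A b n c (b + 2) : ℝ) + 4 ≤ A b n (c + 1) (b + 2) := by exact_mod_cast hcA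
    rw [div_le_iff₀ (by positivity)]
    linarith

/-! ### Saws and the computable function of bounded variation built from them -/

theorem abs_abs_sub_round_sub_le (x y : ℝ) : |(|x - round x| - |y - round y|)| ≤ |x - y| := by
  have key : ∀ x y : ℝ, |x - round x| - |y - round y| ≤ |x - y| := fun x y => by
    have h1 := round_le x (round y)
    have h2 := abs_sub_le x y (round y)
    linarith
  rw [abs_le]
  have := key x y
  have := key y x
  rw [abs_sub_comm y x] at this
  constructor <;> linarith

theorem abs_clamp_sub_clamp_le (x y : ℝ) :
    |max 0 (min 1 x) - max 0 (min 1 y)| ≤ |x - y| := by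
  refine (abs_max_sub_max_le_max 0 _ 0 _).trans (max_le (by simp) ?_)
  exact (abs_min_sub_min_le_max 1 x 1 y).trans (max_le (by simp) le_rfl)

/-- A saw with `K` teeth of height `2 ^ (-k-1)` on the interval `[l / D, (l + 1) / D]`. -/
noncomputable def saw (k K D l : ℕ) (x : ℝ) : ℝ :=
  (1 / 2) ^ k * |K * max 0 (min 1 (x * D - l)) - round (K * max 0 (min 1 (x * D - l)))|

theorem saw_nonneg (k K D l : ℕ) (x : ℝ) : 0 ≤ saw k K D l x := by
  unfold saw
  positivity

theorem saw_le (k K D l : ℕ) (x : ℝ) : saw k K D l x ≤ (1 / 2) ^ (k + 1) := by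
  rw [saw, pow_succ]
  exact mul_le_mul_of_nonneg_left (abs_sub_round _) (by positivity)

theorem abs_saw_sub_saw_le (k K D l : ℕ) (x y : ℝ) : |saw k K D l x - saw k K D l y| ≤
    (1 / 2) ^ k * K * |max 0 (min 1 (x * D - l)) - max 0 (min 1 (y * D - l))| := by
  rw [saw, saw, ← mul_sub, abs_mul, abs_of_nonneg (by positivity : (0 : ℝ) ≤ (1 / 2) ^ k),
    mul_assoc]
  refine mul_le_mul_of_nonneg_left ((abs_abs_sub_round_sub_le _ _).trans_eq ?_) (by positivity)
  rw [← mul_sub, abs_mul, Nat.abs_cast]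

theorem saw_eq_zero {k K D l : ℕ} {x : ℝ} (h : x * D ≤ l ∨ l + 1 ≤ x * D) :
    saw k K D l x = 0 := by
  rcases h with h | h
  · rw [saw, min_eq_right (by linarith), max_eq_left (by linarith)]
    simp
  · rw [saw, min_eq_left (by linarith), max_eq_right (by linarith)]
    simp

/-- The numerator of the value of a saw at `p / q`. -/
def sawNumerator (K D l p q : ℕ) : ℕ :=
  min (K * min (p * D - l * q) q % q) (q - K * min (p * D - l * q) q % q)

@[fun_prop]
theorem computableIn_sawNumerator {O : Set (ℕ →. ℕ)} {α : Type*} [Primcodable α]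
    {K D l p q : α → ℕ} (hK : ComputableIn O K) (hD : ComputableIn O D) (hl : ComputableIn O l)
    (hp : ComputableIn O p) (hq : ComputableIn O q) :
    ComputableIn O fun a => sawNumerator (K a) (D a) (l a) (p a) (q a) := by
  unfold sawNumerator
  fun_prop

/-- Truncated subtraction performs the clamping at `0`, and the distance of `m / q` to the nearest
integer is `min (m % q) (q - m % q) / q`. -/
theorem saw_div (k K D l p : ℕ) {q : ℕ} (hq : 0 < q) :
    saw k K D l (p / q) = (1 / 2) ^ k * sawNumerator K D l p q / q := by
  have hq' : (0 : ℝ) < q := by exact_mod_cast hq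
  have e : (K : ℝ) * max 0 (min 1 ((p : ℝ) / q * D - l)) =
      ((K * min (p * D - l * q) q : ℕ) : ℝ) / q := by
    have e1 : (p : ℝ) / q * D - l = (p * D - l * q) / q := by field_simp
    rw [Nat.cast_mul, mul_div_assoc, Nat.cast_min, ← min_div_div_right hq'.le, div_self hq'.ne', e1]
    rcases le_total (l * q) (p * D) with h | h
    · have h' : (l * q : ℝ) ≤ p * D := by exact_mod_cast h
      rw [Nat.cast_sub h, max_eq_right, min_comm]
      · push_cast
        rfl
      · exact le_min zero_le_one (div_nonneg (by linarith) hq'.le)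
    · have h' : (p * D : ℝ) ≤ l * q := by exact_mod_cast h
      rw [Nat.sub_eq_zero_of_le h, max_eq_left]
      · simp
      · exact (min_le_right _ _).trans (div_nonpos_of_nonpos_of_nonneg (by linarith) hq'.le)
  rw [saw, e, abs_sub_round_div_natCast_eq, mul_div_assoc, sawNumerator]

/-- If `Q k` holds, where `k` codes `(b, s)`, a saw of height `2 ^ (-k-1)` and total variation
`2 ^ (1-b)` on the `c s`-th of the `2 ^ s` equal parts of `[2 ^ (-b-1), 2 ^ (-b)]`. -/
noncomputable def bump (Q : ℕ → Prop) [DecidablePred Q] (c : ℕ → ℕ) (k : ℕ) (x : ℝ) : ℝ :=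
  if Q k then saw k (2 ^ (k + 1 - k.unpair.1)) (2 ^ (k.unpair.1 + 1 + k.unpair.2))
    (2 ^ k.unpair.2 + c k.unpair.2) x else 0

section

variable {Q : ℕ → Prop} [DecidablePred Q] {c : ℕ → ℕ}

theorem bump_nonneg (k : ℕ) (x : ℝ) : 0 ≤ bump Q c k x := by
  unfold bump
  split_ifs
  exacts [saw_nonneg _ _ _ _ _, le_rfl]

theorem bump_le (k : ℕ) (x : ℝ) : bump Q c k x ≤ (1 / 2) ^ (k + 1) := by
  unfold bump
  split_ifs
  exacts [saw_le _ _ _ _ _, by positivity]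

/-- This is the total variation of the saw with index `k`. The truncated exponent is harmless
because `k.unpair.1 ≤ k`. -/
theorem pow_mul_teeth (k : ℕ) :
    (1 / 2 : ℝ) ^ k * (2 ^ (k + 1 - k.unpair.1) : ℕ) = 2 * (1 / 2) ^ k.unpair.1 := by
  obtain ⟨m, hm⟩ := Nat.exists_eq_add_of_le (Nat.unpair_left_le k)
  generalize k.unpair.1 = b at *
  subst hm
  rw [show b + m + 1 - b = m + 1 by omega, pow_add]
  have : (1 / 2 : ℝ) ^ m * 2 ^ m = 1 := by rw [← mul_pow]; norm_num
  push_cast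
  rw [pow_succ]
  linear_combination 2 * (1 / 2 : ℝ) ^ b * this

/-- A nondecreasing function that bounds the increments of the `k`-th bump. -/
noncomputable def ramp (Q : ℕ → Prop) [DecidablePred Q] (c : ℕ → ℕ) (k : ℕ) (x : ℝ) : ℝ :=
  if Q k then 2 * (1 / 2) ^ k.unpair.1 * max 0 (min 1 (x * (2 ^ (k.unpair.1 + 1 + k.unpair.2) : ℕ)
    - (2 ^ k.unpair.2 + c k.unpair.2 : ℕ))) else 0

theorem ramp_mono (k : ℕ) : Monotone (ramp Q c k) := by
  intro x y hxy
  unfold ramp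
  split_ifs
  · gcongr
  · exact le_rfl

theorem ramp_nonneg (k : ℕ) (x : ℝ) : 0 ≤ ramp Q c k x := by
  unfold ramp
  split_ifs
  · positivity
  · exact le_rfl

theorem abs_bump_sub_bump_le_ramp (k : ℕ) {x y : ℝ} (h : x ≤ y) :
    |bump Q c k x - bump Q c k y| ≤ ramp Q c k y - ramp Q c k x := by
  have hm := ramp_mono (Q := Q) (c := c) k h
  rw [← abs_of_nonneg (sub_nonneg.2 hm), abs_sub_comm (ramp Q c k y)]
  unfold bump ramp
  split_ifs
  · refine (abs_saw_sub_saw_le _ _ _ _ _ _).trans_eq ?_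
    rw [pow_mul_teeth, ← mul_sub, abs_mul,
      abs_of_nonneg (by positivity : (0 : ℝ) ≤ 2 * (1 / 2) ^ k.unpair.1)]
  · simp

/-- With `k` coding `(b, s)`, the Lipschitz constant is `2 ^ (1 - b) * 2 ^ (b + 1 + s) = 2 ^ (s +
2)`, and `s ≤ k`. -/
theorem abs_bump_sub_bump_le (k : ℕ) (x y : ℝ) :
    |bump Q c k x - bump Q c k y| ≤ 2 ^ (k + 2) * |x - y| := by
  unfold bump
  split_ifs
  · refine (abs_saw_sub_saw_le _ _ _ _ _ _).trans ?_
    refine (mul_le_mul_of_nonneg_left (abs_clamp_sub_clamp_le _ _) (by positivity)).trans ?_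
    rw [pow_mul_teeth, sub_sub_sub_cancel_right, ← sub_mul, abs_mul, Nat.abs_cast, mul_comm |x - y|,
      ← mul_assoc]
    refine mul_le_mul_of_nonneg_right ?_ (abs_nonneg _)
    have e : (1 / 2 : ℝ) ^ k.unpair.1 * 2 ^ k.unpair.1 = 1 := by rw [← mul_pow]; norm_num
    calc (2 : ℝ) * (1 / 2) ^ k.unpair.1 * (2 ^ (k.unpair.1 + 1 + k.unpair.2) : ℕ)
        = 2 ^ (k.unpair.2 + 2) * ((1 / 2 : ℝ) ^ k.unpair.1 * 2 ^ k.unpair.1) := by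
          push_cast
          ring
      _ = 2 ^ (k.unpair.2 + 2) := by rw [e, mul_one]
      _ ≤ 2 ^ (k + 2) := by
          have := Nat.unpair_right_le k
          gcongr
          norm_num
  · simp only [sub_self, abs_zero]
    positivity

theorem hasSum_half (n : ℕ) : HasSum (fun k : ℕ => (1 / 2 : ℝ) ^ (k + n + 1)) ((1 / 2) ^ n) := by
  have := hasSum_geometric_two.mul_left ((1 / 2 : ℝ) ^ (n + 1))
  have e1 : (fun k : ℕ => (1 / 2 : ℝ) ^ (n + 1) * (1 / 2) ^ k) = fun k => (1 / 2) ^ (k + n + 1) := by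
    funext k
    ring
  have e2 : (1 / 2 : ℝ) ^ (n + 1) * 2 = (1 / 2) ^ n := by ring
  rwa [e1, e2] at this

theorem summable_bump (x : ℝ) : Summable fun k => bump Q c k x :=
  Summable.of_nonneg_of_le (fun k => bump_nonneg k x) (fun k => bump_le k x) (hasSum_half 0).summable

/-- The sum of all bumps. -/
noncomputable def bumps (Q : ℕ → Prop) [DecidablePred Q] (c : ℕ → ℕ) (x : ℝ) : ℝ :=
  ∑' k, bump Q c k x

theorem abs_bumps_sub_sum_le (n : ℕ) (x : ℝ) :
    |bumps Q c x - ∑ k ∈ Finset.range n, bump Q c k x| ≤ (1 / 2) ^ n := by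
  have h := (summable_bump (Q := Q) (c := c) x).sum_add_tsum_nat_add n
  have hs := (summable_nat_add_iff n).2 (summable_bump (Q := Q) (c := c) x)
  rw [bumps, ← h, add_sub_cancel_left, abs_of_nonneg (tsum_nonneg fun k => bump_nonneg _ x),
    ← (hasSum_half n).tsum_eq]
  exact hs.tsum_le_tsum (fun k => bump_le _ x) (hasSum_half n).summable

/-- Half of the error comes from the two tails after `n + 2` bumps. The other half comes from the
first `n + 2` bumps, whose sum has Lipschitz constant at most `2 ^ (n + 4)`. -/
theorem abs_bumps_sub_bumps_le {n : ℕ} {x y : ℝ} (h : |x - y| ≤ (1 / 2) ^ (2 * n + 5)) :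
    |bumps Q c x - bumps Q c y| ≤ (1 / 2) ^ n := by
  have h1 := abs_bumps_sub_sum_le (Q := Q) (c := c) (n + 2) x
  have h2 := abs_bumps_sub_sum_le (Q := Q) (c := c) (n + 2) y
  have h3 : |∑ k ∈ Finset.range (n + 2), bump Q c k x - ∑ k ∈ Finset.range (n + 2), bump Q c k y|
      ≤ (1 / 2) ^ (n + 1) := by
    rw [← Finset.sum_sub_distrib]
    refine (Finset.abs_sum_le_sum_abs _ _).trans ?_
    refine (Finset.sum_le_sum fun k _ => abs_bump_sub_bump_le k x y).trans ?_
    rw [← Finset.sum_mul]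
    have h4 : ∑ k ∈ Finset.range (n + 2), (2 : ℝ) ^ (k + 2) ≤ 2 ^ (n + 4) := by
      have : ∀ k : ℕ, (2 : ℝ) ^ (k + 2) = 2 ^ k * 4 := fun k => by ring
      simp only [this, ← Finset.sum_mul]
      rw [geom_sum_eq (by norm_num)]
      ring_nf
      linarith
    calc _ ≤ (2 : ℝ) ^ (n + 4) * (1 / 2) ^ (2 * n + 5) :=
          mul_le_mul h4 h (abs_nonneg _) (by positivity)
      _ = (2 ^ (n + 4) * (1 / 2) ^ (n + 4)) * (1 / 2) ^ (n + 1) := by ring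
      _ = (1 / 2) ^ (n + 1) := by rw [← mul_pow]; norm_num
  rw [abs_le] at h1 h2 h3 ⊢
  have e1 : (1 / 2 : ℝ) ^ (n + 1) = (1 / 2) ^ n / 2 := by ring
  have e2 : (1 / 2 : ℝ) ^ (n + 2) = (1 / 2) ^ n / 4 := by ring
  rw [e1] at h3
  rw [e2] at h1 h2
  constructor <;> linarith

/-- Each first component `b` occurs for at most one index satisfying `Q`, so the heights `2 * 2 ^
(-b)` form a subfamily of a geometric series. -/
theorem summable_ramp (hQ : ∀ k k', Q k → Q k' → k.unpair.1 = k'.unpair.1 → k = k') (x : ℝ) :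
    Summable fun k => ramp Q c k x := by
  have h : Summable fun k => if Q k then 2 * (1 / 2 : ℝ) ^ k.unpair.1 else 0 := by
    have h1 : Summable fun b : ℕ => 2 * (1 / 2 : ℝ) ^ b := summable_geometric_two.mul_left 2
    have h2 : Function.Injective fun k : {k | Q k} => (k : ℕ).unpair.1 := fun k k' h =>
      Subtype.ext (hQ _ _ k.2 k'.2 h)
    have h3 := h1.comp_injective h2
    refine ((summable_subtype_iff_indicator (s := {k | Q k})
      (f := fun k : ℕ => 2 * (1 / 2 : ℝ) ^ k.unpair.1)).1 h3).congr fun k => ?_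
    simp [Set.indicator]
  refine Summable.of_nonneg_of_le (fun k => ramp_nonneg k x) (fun k => ?_) h
  unfold ramp
  split_ifs
  · exact mul_le_of_le_one_right (by positivity) (max_le zero_le_one (min_le_left _ _))
  · exact le_rfl

/-- The sum of the ramps is nondecreasing and dominates the absolute increments of `bumps`, hence
also its variation. -/
theorem boundedVariationOn_bumps
    (hQ : ∀ k k', Q k → Q k' → k.unpair.1 = k'.unpair.1 → k = k') :
    BoundedVariationOn (fun x : Set.Icc (0 : ℝ) 1 => bumps Q c x) Set.univ := by
  set M : Set.Icc (0 : ℝ) 1 → ℝ := fun x => ∑' k, ramp Q c k x with hM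
  have hMs := fun x : ℝ => summable_ramp (c := c) hQ x
  have hMm : Monotone M := fun x y hxy =>
    (hMs _).tsum_le_tsum (fun k => ramp_mono k hxy) (hMs _)
  have hFM : ∀ x y : Set.Icc (0 : ℝ) 1, x ≤ y → |bumps Q c x - bumps Q c y| ≤ M y - M x := by
    intro x y hxy
    rw [bumps, bumps, ← (summable_bump _).tsum_sub (summable_bump _)]
    exact tsum_of_norm_bounded (f := fun k => bump Q c k x - bump Q c k y) ((hMs y).hasSum.sub (hMs x).hasSum)
      fun k => abs_bump_sub_bump_le_ramp (Q := Q) (c := c) k hxy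
  have hMv : eVariationOn M Set.univ ≤ ENNReal.ofReal (M 1 - M 0) := by
    have := ((hMm.monotoneOn Set.univ).eVariationOn_eq (Set.mem_univ 0) (Set.mem_univ 1)).le
    rwa [Set.univ_inter, Set.eq_univ_of_forall (s := Set.Icc (0 : Set.Icc (0 : ℝ) 1) 1)
      fun x => ⟨x.2.1, x.2.2⟩] at this
  refine ne_top_of_le_ne_top ENNReal.ofReal_ne_top (le_trans (iSup_le fun p => ?_) hMv)
  refine le_trans (Finset.sum_le_sum fun i _ => ?_) (eVariationOn.sum_le (f := M) (n := p.1)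
    p.2.2.1 fun i => p.2.2.2 i)
  have h := p.2.2.1 (Nat.le_succ i)
  rw [edist_comm, edist_dist, edist_dist]
  refine ENNReal.ofReal_le_ofReal ((hFM _ _ h).trans (le_abs_self _))

theorem unitRat_toReal (i : ℕ) : ((unitRat i).toReal : ℝ) =
    (min i.unpair.1 (i.unpair.2 + 1) : ℕ) / (i.unpair.2 + 1 : ℕ) := by
  simp [unitRat, IQ.toReal]

theorem isComputableFunction_bumps (hQ : ComputableIn {} fun k => decide (Q k))
    (hc : ComputableIn {} c) :
    IsComputableFunction fun x : Set.Icc (0 : ℝ) 1 => bumps Q c x := by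
  -- The `n`-th approximation at `p / q` is the exact sum of the first `n` bumps, over the common
  -- denominator `2 ^ n * q`.
  refine ⟨⟨fun i n => Nat.pair (∑ k ∈ Finset.range n, if Q k then 2 ^ (n - k) *
      sawNumerator (2 ^ (k + 1 - k.unpair.1)) (2 ^ (k.unpair.1 + 1 + k.unpair.2))
        (2 ^ k.unpair.2 + c k.unpair.2) (min i.unpair.1 (i.unpair.2 + 1)) (i.unpair.2 + 1) else 0)
      (Nat.pair 0 (2 ^ n * (i.unpair.2 + 1) - 1)), ?_, fun i n => ?_⟩,
    ⟨fun n => 2 * n + 5, ?_, fun n x y h => abs_bumps_sub_bumps_le (Q := Q) (c := c) h⟩⟩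
  · have hQ' : ComputableIn {} fun q : (ℕ × ℕ) × ℕ => decide (Q q.2) :=
      ComputableIn.comp hQ (g := fun q : (ℕ × ℕ) × ℕ => q.2) (by fun_prop)
    have h : ComputableIn {} fun q : (ℕ × ℕ) × ℕ => if Q q.2 then 2 ^ (q.1.2 - q.2) *
      sawNumerator (2 ^ (q.2 + 1 - q.2.unpair.1)) (2 ^ (q.2.unpair.1 + 1 + q.2.unpair.2))
        (2 ^ q.2.unpair.2 + c q.2.unpair.2) (min q.1.1.unpair.1 (q.1.1.unpair.2 + 1))
        (q.1.1.unpair.2 + 1) else 0 := .ite hQ' (by fun_prop) (by fun_prop)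
    have h' := sum_range (n := fun p : ℕ × ℕ => p.2) (f := fun p k => if Q k then 2 ^ (p.2 - k) *
      sawNumerator (2 ^ (k + 1 - k.unpair.1)) (2 ^ (k.unpair.1 + 1 + k.unpair.2))
        (2 ^ k.unpair.2 + c k.unpair.2) (min p.1.unpair.1 (p.1.unpair.2 + 1))
        (p.1.unpair.2 + 1) else 0) (by fun_prop) h
    exact (ComputableIn.nat_pair h' (by fun_prop)).computable
  · refine le_trans (le_of_eq ?_) (abs_bumps_sub_sum_le (Q := Q) (c := c) n ((unitRat i).toReal : ℝ))
    congr 2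
    rw [rat_cast, unitRat_toReal]
    simp only [Nat.unpair_pair, Nat.cast_zero, sub_zero]
    have hq : 0 < i.unpair.2 + 1 := Nat.succ_pos _
    generalize i.unpair.2 + 1 = q at *
    generalize min i.unpair.1 q = p at *
    have h1 : ((2 ^ n * q - 1 : ℕ) : ℝ) + 1 = 2 ^ n * q := by
      have : 1 ≤ 2 ^ n * q := Nat.one_le_iff_ne_zero.2 (by positivity)
      rw [Nat.cast_sub this]
      simp
    have hq' : (0 : ℝ) < q := by exact_mod_cast hq
    rw [h1, div_eq_iff (by positivity), Nat.cast_sum, Finset.sum_mul]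
    refine Finset.sum_congr rfl fun k hk => ?_
    unfold bump
    split_ifs
    · rw [saw_div _ _ _ _ _ hq]
      obtain ⟨m, rfl⟩ := Nat.exists_eq_add_of_le (Finset.mem_range.1 hk).le
      rw [Nat.add_sub_cancel_left, Nat.cast_mul]
      generalize ((sawNumerator _ _ _ _ _ : ℕ) : ℝ) = z
      have e : (1 / 2 : ℝ) ^ k * 2 ^ k = 1 := by rw [← mul_pow]; norm_num
      rw [div_mul_eq_mul_div, eq_div_iff hq'.ne', pow_add]
      push_cast
      linear_combination (-(z * 2 ^ m * q)) * e
    · simp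
  · refine ComputableIn.computable ?_
    fun_prop

/-- Bumps with different first components `b` live on dyadic intervals `[2 ^ (-b-1), 2 ^ (-b)]` with
disjoint interiors, and `hQ` allows only one bump for each `b`. -/
theorem bumps_eq_bump (hQ : ∀ k k', Q k → Q k' → k.unpair.1 = k'.unpair.1 → k = k')
    (hc : ∀ s, c s < 2 ^ s) {k : ℕ} (hk : Q k) {x : ℝ} (h1 : 1 ≤ x * 2 ^ (k.unpair.1 + 1))
    (h2 : x * 2 ^ k.unpair.1 ≤ 1) : bumps Q c x = bump Q c k x := by
  refine tsum_eq_single k fun k' hk' => ?_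
  unfold bump
  split_ifs with hQk'
  · refine saw_eq_zero ?_
    have hne : k'.unpair.1 ≠ k.unpair.1 := fun h => hk' (hQ _ _ hQk' hk h)
    have hx : 0 < x := by
      by_contra! hx
      have := mul_nonpos_of_nonpos_of_nonneg hx (by positivity : (0 : ℝ) ≤ 2 ^ (k.unpair.1 + 1))
      linarith
    generalize k'.unpair.1 = b' at *
    generalize k'.unpair.2 = s at *
    generalize k.unpair.1 = b at *
    have hs := hc s
    have hs' : (c s : ℝ) + 1 ≤ 2 ^ s := by exact_mod_cast hs
    have hp : (0 : ℝ) < 2 ^ s := by positivity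
    push_cast
    rcases hne.lt_or_gt with h | h
    · left
      have : x * 2 ^ (b' + 1) ≤ 1 := le_trans (by gcongr; norm_num; omega) h2
      rw [pow_add, ← mul_assoc]
      have := mul_le_mul_of_nonneg_right this hp.le
      linarith [Nat.cast_nonneg (α := ℝ) (c s)]
    · right
      have : 1 ≤ x * 2 ^ b' := h1.trans (by gcongr; norm_num; omega)
      rw [pow_add, pow_succ, ← mul_assoc, ← mul_assoc]
      have := mul_le_mul_of_nonneg_right this hp.le
      linarith
  · rfl

/-! ### Increments forced on a slope bound -/

/-- An index of the rational `(2 ^ n + c) / 2 ^ (b + 1 + n)`. -/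
def dyadicIndex (b n c : ℕ) : ℕ := Nat.pair (2 ^ n + c) (2 ^ (b + 1 + n) - 1)

theorem unitRat_coe (p q : ℕ) (hq : 0 < q) :
    ((unitRat (Nat.pair p (q - 1)) : IQ) : ℚ) = (min p q : ℕ) / q := by
  simp only [unitRat, Nat.unpair_pair, Nat.sub_add_cancel hq]
  rw [Nat.cast_sub hq]
  simp

theorem unitRat_eq_unitRat {p q p' q' : ℕ} (hq : 0 < q) (hq' : 0 < q')
    (h : min p q * q' = min p' q' * q) :
    unitRat (Nat.pair p (q - 1)) = unitRat (Nat.pair p' (q' - 1)) := by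
  refine Subtype.ext ?_
  rw [unitRat_coe _ _ hq, unitRat_coe _ _ hq', div_eq_div_iff (by positivity) (by positivity)]
  exact_mod_cast h

theorem isDyadic_unitRat {g : IQ → ℝ} (hg : Monotone g) (b : ℕ) :
    IsDyadic fun n c => g (unitRat (dyadicIndex b n c)) := by
  refine ⟨fun n c c' h => hg ?_, fun n c => ?_⟩
  · rw [dyadicIndex, dyadicIndex, ← Subtype.coe_le_coe, unitRat_coe _ _ (by positivity),
      unitRat_coe _ _ (by positivity)]
    gcongr
  · congr 1
    refine unitRat_eq_unitRat (by positivity) (by positivity) ?_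
    rw [pow_succ, ← add_assoc, pow_succ, mul_comm (2 ^ n), ← mul_add, mul_comm (2 ^ (b + 1 + n)),
      Nat.mul_min_mul_left]
    ring

/-- Values at the tips of the teeth and between them. -/
theorem bumps_tooth (hQ : ∀ k k', Q k → Q k' → k.unpair.1 = k'.unpair.1 → k = k')
    (hc : ∀ s, c s < 2 ^ s) {k : ℕ} (hk : Q k) {j : ℕ}
    (hj : j ≤ 2 * 2 ^ (k + 1 - k.unpair.1)) :
    bumps Q c (unitRat (Nat.pair
      (2 * 2 ^ (k + 1 - k.unpair.1) * (2 ^ k.unpair.2 + c k.unpair.2) + j)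
      (2 * 2 ^ (k + 1 - k.unpair.1) * 2 ^ (k.unpair.1 + 1 + k.unpair.2) - 1))).toReal =
    (1 / 2) ^ (k + 1) * (j % 2 : ℕ) := by
  have hcs := hc k.unpair.2
  have hK : 0 < 2 ^ (k + 1 - k.unpair.1) := by positivity
  have hlD : 2 ^ k.unpair.2 + c k.unpair.2 + 1 ≤ 2 ^ (1 + k.unpair.2) := by
    rw [pow_add]
    omega
  have hlD' : 2 ^ (1 + k.unpair.2) ≤ 2 ^ (k.unpair.1 + 1 + k.unpair.2) := by
    gcongr <;> omega
  have hx : ∀ p q, 0 < q → p ≤ q →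
      ((unitRat (Nat.pair p (q - 1))).toReal : ℝ) = (p : ℝ) / (q : ℕ) := by
    intro p q hq hpq
    simp only [IQ.toReal]
    rw [unitRat_coe p q hq, min_eq_left hpq]
    simp
  rw [hx _ _ (by positivity)]
  · rw [bumps_eq_bump hQ hc hk]
    · unfold bump
      rw [if_pos hk, saw_div _ _ _ _ _ (by positivity), sawNumerator]
      generalize 2 ^ (k + 1 - k.unpair.1) = K at *
      generalize 2 ^ k.unpair.2 + c k.unpair.2 = l at *
      have hD : 0 < 2 ^ (k.unpair.1 + 1 + k.unpair.2) := by positivity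
      generalize 2 ^ (k.unpair.1 + 1 + k.unpair.2) = D at *
      have e1 : (2 * K * l + j) * D - l * (2 * K * D) = j * D := by
        rw [show (2 * K * l + j) * D = l * (2 * K * D) + j * D by ring, Nat.add_sub_cancel_left]
      have e2 : K * (j * D) % (2 * K * D) = K * D * (j % 2) := by
        rw [show K * (j * D) = K * D * j by ring, show 2 * K * D = K * D * 2 by ring,
          Nat.mul_mod_mul_left]
      rw [e1, min_eq_left (Nat.mul_le_mul_right _ hj), e2, min_eq_left]
      · have : (0 : ℝ) < K := by exact_mod_cast hK
        have : (0 : ℝ) < D := by exact_mod_cast hD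
        push_cast
        field_simp
        ring
      · have : K * D * (j % 2) ≤ K * D * 1 := by gcongr; omega
        have : 2 * K * D = K * D + K * D := by ring
        omega
    · rw [div_mul_eq_mul_div, one_le_div (by positivity)]
      norm_cast
      calc _ = 2 * 2 ^ (k + 1 - k.unpair.1) * 2 ^ k.unpair.2 * 2 ^ (k.unpair.1 + 1) := by ring
        _ ≤ _ := by
          refine Nat.mul_le_mul_right _ (le_trans ?_ (Nat.le_add_right _ _))
          exact Nat.mul_le_mul_left _ (Nat.le_add_right _ _)
    · rw [div_mul_eq_mul_div, div_le_one (by positivity)]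
      norm_cast
      calc _ ≤ 2 * 2 ^ (k + 1 - k.unpair.1) * (2 ^ k.unpair.2 + c k.unpair.2 + 1)
            * 2 ^ k.unpair.1 := Nat.mul_le_mul_right _ (by rw [mul_add_one]; omega)
        _ ≤ 2 * 2 ^ (k + 1 - k.unpair.1) * 2 ^ (1 + k.unpair.2) * 2 ^ k.unpair.1 := by gcongr
        _ = _ := by ring
  · calc _ ≤ 2 * 2 ^ (k + 1 - k.unpair.1) * (2 ^ k.unpair.2 + c k.unpair.2)
          + 2 * 2 ^ (k + 1 - k.unpair.1) := by gcongr
      _ = 2 * 2 ^ (k + 1 - k.unpair.1) * (2 ^ k.unpair.2 + c k.unpair.2 + 1) := by ring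
      _ ≤ _ := by gcongr; exact hlD.trans hlD'

/-- The saw rises `K = 2 ^ (k + 1 - b)` times by `2 ^ (-k-1)`. On each rise `g` gains at least as
much, and on the descents it loses nothing, so it gains `2 ^ (-b)` in all. -/
theorem bumps_increment (hQ : ∀ k k', Q k → Q k' → k.unpair.1 = k'.unpair.1 → k = k')
    (hc : ∀ s, c s < 2 ^ s) {g : IQ → ℝ} (hg : Monotone g)
    (hs : SlopeLE (fun q => bumps Q c q.toReal) g) {b s : ℕ} (hbs : Q (Nat.pair b s)) :
    1 ≤ 2 ^ b * (g (unitRat (dyadicIndex b s (c s + 1))) - g (unitRat (dyadicIndex b s (c s)))) := by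
  have htooth := fun j => bumps_tooth hQ hc hbs (j := j)
  have hteeth := pow_mul_teeth (Nat.pair b s)
  simp only [Nat.unpair_pair] at htooth hteeth
  have hK : 0 < 2 ^ (Nat.pair b s + 1 - b) := by positivity
  have hD : 0 < 2 ^ (b + 1 + s) := by positivity
  set k := Nat.pair b s
  unfold dyadicIndex
  generalize 2 ^ (k + 1 - b) = K at *
  rw [← add_assoc (2 ^ s)]
  generalize 2 ^ s + c s = l at *
  generalize 2 ^ (b + 1 + s) = D at *
  -- The points `y j` divide the support into `2 * K` equal parts; the odd ones are the tips of the
  -- teeth.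
  set y : ℕ → IQ := fun j => unitRat (Nat.pair (2 * K * l + j) (2 * K * D - 1)) with hy
  have hymono : Monotone y := fun i j h => by
    simp only [hy]
    rw [← Subtype.coe_le_coe, unitRat_coe _ _ (by positivity), unitRat_coe _ _ (by positivity)]
    gcongr
  have hind : ∀ i ≤ K, g (y 0) + i * (1 / 2) ^ (k + 1) ≤ g (y (2 * i)) := by
    intro i hi
    induction i with
    | zero => simp
    | succ i ih =>
      have h0 := ih (by omega)
      have h1 := htooth (2 * i) (by omega)
      have h2 := htooth (2 * i + 1) (by omega)
      rw [show 2 * i % 2 = 0 by omega] at h1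
      rw [show (2 * i + 1) % 2 = 1 by omega] at h2
      have hpos : (0 : ℝ) < (1 / 2) ^ (k + 1) := by positivity
      have hle : y (2 * i) ≤ y (2 * i + 1) := hymono (Nat.le_succ _)
      have hlt : y (2 * i) < y (2 * i + 1) := by
        refine lt_of_le_of_ne hle fun h => ?_
        simp only [hy] at h
        rw [h, h2] at h1
        simp at h1
      have h3 := hs _ _ hlt
      simp only [hy] at h3
      rw [h1, h2] at h3
      have h4 : g (y (2 * i + 1)) ≤ g (y (2 * (i + 1))) := hg (hymono (by omega))
      simp only [hy] at h0 h4 ⊢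
      push_cast at h3 ⊢
      linarith
  have h0 : unitRat (Nat.pair l (D - 1)) = y 0 :=
    unitRat_eq_unitRat hD (by positivity) (by
      rw [add_zero, Nat.mul_min_mul_left]
      ring)
  have h1 : unitRat (Nat.pair (l + 1) (D - 1)) = y (2 * K) :=
    unitRat_eq_unitRat hD (by positivity) (by
      rw [← Nat.mul_add_one, Nat.mul_min_mul_left]
      ring)
  rw [h0, h1]
  have h2 := hind K le_rfl
  have h3 : (K : ℝ) * (1 / 2) ^ (k + 1) = (1 / 2) ^ b := by
    rw [pow_succ]
    linarith
  rw [h3] at h2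
  have e : (2 : ℝ) ^ b * (1 / 2) ^ b = 1 := by rw [← mul_pow]; norm_num
  have := mul_le_mul_of_nonneg_left h2 (pow_nonneg (zero_le_two (α := ℝ)) b)
  linarith

end

/-! ### From slope bounds to PA degree -/

theorem hasPADegree_of_computesSlopeBound {B : ℕ → Bool}
    (h : ∀ f : Set.Icc (0 : ℝ) 1 → ℝ, IsComputableFunction f → BoundedVariationOn f Set.univ →
      ComputesSlopeBound B f) : HasPADegree B := by
  intro P hP hPne
  obtain ⟨T, hTc, hT, hTne, hTP⟩ := hP.exists_tree hPne
  obtain ⟨c, hc, hcT⟩ : ∃ c : ℕ → ℕ, ComputableIn {} c ∧ ∀ s, T s (c s) = true :=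
    ⟨fun s => Nat.find (hTne s), find (p := fun s e => T s e = true) (.decide_eq_true' hTc) hTne,
      fun s => Nat.find_spec (hTne s)⟩
  have hclt : ∀ s, c s < 2 ^ s := fun s => hT.lt (hcT s)
  -- A node has only one first stage of death, so each `b` contributes at most one saw.
  have hQ : ∀ k k' : ℕ, Dies T k.unpair.1 k.unpair.2 → Dies T k'.unpair.1 k'.unpair.2 →
      k.unpair.1 = k'.unpair.1 → k = k' := by
    intro k k' hk hk' e
    rw [← Nat.pair_unpair k, ← Nat.pair_unpair k', e]
    rw [e] at hk
    rw [hk.unique hk']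
  have hQc : ComputableIn {} fun k : ℕ => decide (Dies T k.unpair.1 k.unpair.2) :=
    computableIn_dies hTc (by fun_prop) (by fun_prop)
  obtain ⟨g, hg, hgB, hs⟩ := h _ (isComputableFunction_bumps hQc hc) (boundedVariationOn_bumps hQ)
  obtain ⟨a, ha⟩ := exists_nat_add_nonneg hg
  obtain ⟨A, hA, hAg⟩ := exists_floor_of_computesFunction hgB a ha
  have hA' : ComputableIn (oracle B) fun p : ℕ × ℕ × ℕ × ℕ =>
      A (dyadicIndex p.1 p.2.1 p.2.2.1) p.2.2.2 := by
    unfold dyadicIndex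
    exact ComputableIn.comp hA (g := fun p : ℕ × ℕ × ℕ × ℕ => (Nat.pair (2 ^ p.2.1 + p.2.2.1)
      (2 ^ (p.1 + 1 + p.2.1) - 1), p.2.2.2)) (by fun_prop)
  obtain ⟨C, hCB, hC, hCT⟩ := exists_path_of_dies_increment (.of_computable hTc.computable) hT hTne
    (isDyadic_unitRat hg) (A := fun b n c t => A (dyadicIndex b n c) t) hA' (a := a)
    (fun b n c t => hAg _ t) fun b s hbs => ⟨c s, hcT s, bumps_increment hQ hclt hg hs (by simpa)⟩
  refine ⟨_, hTP C hC hCT, ?_⟩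
  have : ComputableIn (oracle B) fun n => C (n + 1) :=
    ComputableIn.comp hCB (g := fun n : ℕ => n + 1) (by fun_prop)
  exact .decide_eq (.nat_mod this (by fun_prop)) (by fun_prop)

end JordanPA

theorem mainTheorem7 (B : ℕ → Bool) :
    (JordanPA.HasPADegree B ↔
      ∀ f : Set.Icc (0 : ℝ) 1 → ℝ,
        JordanPA.IsComputableFunction f → BoundedVariationOn f Set.univ →
          JordanPA.ComputesSlopeBound B f) ∧
    (∀ f : Set.Icc (0 : ℝ) 1 → ℝ,
      JordanPA.IsComputableFunction f → BoundedVariationOn f Set.univ →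
        (JordanPA.ComputesSlopeBound B f ↔ JordanPA.ComputesJordanDecomposition B f)) :=
  ⟨⟨fun hB _ hf hbv => hB.computesSlopeBound hf hbv, JordanPA.hasPADegree_of_computesSlopeBound⟩,
    fun _ hf hbv => ⟨fun h => h.computesJordanDecomposition hf hbv,
      fun h => h.computesSlopeBound⟩⟩
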